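/- Let $\Omega$ be a locally compact Hausdorff space with $\dim\Omega\le\ell$ for some $\ell\in\mathbb N$, i.e. every locally finite open cover of $\Omega$ has a locally finite open refinement that covers $\Omega$ and in which every point lies in at most $\ell+1$ members. Let $\mathcal U=\{\Omega,(A_t)_{t\in\Omega},\Theta\}$ be a locally trivial continuous field of non-zero $C^*$-algebras over $\Omega$ (in the sense of Dixmier) such that every $A_t$ contains a strictly positive element, that is, a positive element at which every non-zero positive linear functional on $A_t$ is strictly positive. Let $\mathfrak A$ be the $C^*$-algebra defined by $\mathcal U$: all $x\in\Theta$ such that $\|x(t)\|$ vanishes at infinity on $\Omega$, with $\|x\|=\sup_{t}\|x(t)\|$. Then the following conditions are equivalent: (i) $\Omega$ is paracompact; (ii) $\mathfrak A$ is left projective and $\mathcal U$ is a disjoint union of $\sigma$-locally trivial continuous fields of $C^*$-algebras with strictly positive elements. Moreover, (i) or (ii) implies (iii) the second continuous Hochschild cohomology group $\mathcal H^2(\mathfrak A,X)$ vanishes for every Banach $\mathfrak A$-bimodule $X$ that is right annihilator, i.e. satisfies $X\cdot\mathfrak A=\{0\}$. Here $\mathfrak A$ is left projective if every morphism of left Banach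 $\mathfrak A$-modules $\varphi:Y\to\mathfrak A$ that has a bounded linear right inverse has a right inverse that is a morphism of left Banach $\mathfrak A$-modules. A field is trivial if it is isomorphic to a constant field. A continuous field over a space $W$ is $\sigma$-locally trivial if $W$ has an open cover $\{U_\mu\}$ such that the field induced on each $U_\mu$ is trivial, and a countable open cover $\{V_j\}$ such that each closure $\overline{V_j}$ is contained in some $U_\mu$. Finally, $\mathcal U$ is a disjoint union of fields of a given kind if $\Omega$ is the disjoint union of open subsets $W_\mu$ such that each induced field $\mathcal U|_{W_\mu}$ is of that kind. -/

import Mathlib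

open Filter Topology
open scoped ENNReal

universe u v w

/-! ### Continuous fields of C⋆-algebras -/

section Fields

/-- A continuous field of C⋆-algebras over `Ω` with fibres `A t`: an involutive subalgebra `Θ` of
the product of the fibres (the continuous vector fields) satisfying the three usual axioms. -/
structure ContinuousField (Ω : Type u) [TopologicalSpace Ω] (A : Ω → Type v)
    [∀ t, NonUnitalCStarAlgebra (A t)] where
  /-- the continuous vector fields -/
  Θ : NonUnitalStarSubalgebra ℂ (∀ t, A t)
  dense_eval : ∀ t, Dense {a : A t | ∃ x ∈ Θ, x t = a}
  continuous_norm : ∀ x ∈ Θ, Continuous fun t => ‖x t‖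
  mem_of_locally_approx : ∀ x : ∀ t, A t,
    (∀ t, ∀ ε : ℝ, 0 < ε → ∃ x' ∈ Θ, ∀ᶠ s in 𝓝 t, ‖x s - x' s‖ ≤ ε) → x ∈ Θ

namespace ContinuousField

variable {Ω : Type u} [TopologicalSpace Ω] {A : Ω → Type v} [∀ t, NonUnitalCStarAlgebra (A t)]

/-- An isomorphism of continuous fields over the same base: a family of ⋆-isomorphisms of the fibres
(automatically isometric) carrying the continuous vector fields of `U` onto those of `U'`. -/
structure Iso {A' : Ω → Type v} [∀ t, NonUnitalCStarAlgebra (A' t)]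
    (U : ContinuousField Ω A) (U' : ContinuousField Ω A') where
  /-- the isomorphisms of the fibres -/
  φ : ∀ t, A t ≃⋆ₐ[ℂ] A' t
  mem_iff : ∀ x : ∀ t, A t, x ∈ U.Θ ↔ (fun t => φ t (x t)) ∈ U'.Θ

/-- A vector field `x` over `Y ⊆ Ω` is continuous at `t₀ ∈ Y` if it can be approximated near `t₀`
(in `Y`) by continuous vector fields of `U`. -/
def IsContinuousAt (U : ContinuousField Ω A) (Y : Set Ω) (x : ∀ t : Y, A t) (t₀ : Y) : Prop :=
  ∀ ε : ℝ, 0 < ε → ∃ x' ∈ U.Θ, ∀ᶠ t : Y in 𝓝 t₀, ‖x t - x' t‖ ≤ ε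

theorem continuous_norm_of_approx {Y : Type*} [TopologicalSpace Y] {B : Y → Type*}
    [∀ t, NonUnitalCStarAlgebra (B t)] (x : ∀ t, B t)
    (h : ∀ t₀, ∀ ε : ℝ, 0 < ε → ∃ x' : ∀ t, B t, (Continuous fun t => ‖x' t‖) ∧
      ∀ᶠ t in 𝓝 t₀, ‖x t - x' t‖ ≤ ε) : Continuous fun t => ‖x t‖ := by
  rw [continuous_iff_continuousAt]
  intro t₀
  rw [Metric.continuousAt_iff']
  intro ε hε
  obtain ⟨x', hc, ha⟩ := h t₀ (ε / 4) (by positivity)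
  have h1 := (Metric.continuousAt_iff'.1 (hc.continuousAt (x := t₀))) (ε / 4) (by positivity)
  have h2 := ha.self_of_nhds
  filter_upwards [ha, h1] with t ht ht'
  rw [Real.dist_eq] at ht' ⊢
  have e1 := abs_norm_sub_norm_le (x t) (x' t)
  have e2 := abs_norm_sub_norm_le (x t₀) (x' t₀)
  rw [abs_lt] at ht' ⊢
  rw [abs_le] at e1 e2
  constructor <;> linarith [e1.1, e1.2, e2.1, e2.2, ht'.1, ht'.2]

/-- The field induced by `U` on `Y ⊆ Ω`. -/
def restrict (U : ContinuousField Ω A) (Y : Set Ω) :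
    ContinuousField Y (fun t : Y => A t) where
  Θ :=
    { carrier := {x | ∀ t₀, U.IsContinuousAt Y x t₀}
      add_mem' := by
        intro x y hx hy t₀ ε hε
        obtain ⟨x', hx', h1⟩ := hx t₀ (ε / 2) (by positivity)
        obtain ⟨y', hy', h2⟩ := hy t₀ (ε / 2) (by positivity)
        refine ⟨x' + y', add_mem hx' hy', ?_⟩
        filter_upwards [h1, h2] with t h1 h2
        calc ‖(x + y) t - (x' + y') t‖ = ‖(x t - x' t) + (y t - y' t)‖ := by
              simp only [Pi.add_apply]; congr 1; abel
          _ ≤ ε := (norm_add_le _ _).trans (by linarith)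
      zero_mem' := fun t₀ ε hε => ⟨0, zero_mem _, by simp [hε.le]⟩
      mul_mem' := by
        intro x y hx hy t₀ ε hε
        obtain ⟨y', hy', h2⟩ := hy t₀ 1 one_pos
        have hyc := (U.continuous_norm y' hy').comp (continuous_subtype_val (p := (· ∈ Y)))
        set M : ℝ := ‖y' t₀‖ + 2 with hM
        have hMpos : 0 < M := by positivity
        have hyb : ∀ᶠ t : Y in 𝓝 t₀, ‖y t‖ ≤ M := by
          have : ∀ᶠ t : Y in 𝓝 t₀, ‖y' t‖ < ‖y' t₀‖ + 1 :=
            hyc.continuousAt.eventually_lt continuousAt_const (by simp)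
          filter_upwards [h2, this] with t h2 h3
          have := norm_le_norm_add_norm_sub' (y t) (y' t)
          linarith
        obtain ⟨x₁, hx₁, h1⟩ := hx t₀ (ε / (2 * M)) (by positivity)
        have hxc := (U.continuous_norm x₁ hx₁).comp (continuous_subtype_val (p := (· ∈ Y)))
        set N : ℝ := ‖x₁ t₀‖ + 1 with hN
        have hNpos : 0 < N := by positivity
        have hxb : ∀ᶠ t : Y in 𝓝 t₀, ‖x₁ t‖ < N :=
          hxc.continuousAt.eventually_lt continuousAt_const (by simp [hN])
        obtain ⟨y₁, hy₁, h3⟩ := hy t₀ (ε / (2 * N)) (by positivity)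
        refine ⟨x₁ * y₁, mul_mem hx₁ hy₁, ?_⟩
        filter_upwards [h1, h3, hyb, hxb] with t h1 h3 hyb hxb
        have e : (x * y) t - (x₁ * y₁) t = (x t - x₁ t) * y t + x₁ t * (y t - y₁ t) := by
          simp only [Pi.mul_apply, sub_mul, mul_sub]; abel
        rw [e]
        calc _ ≤ ‖x t - x₁ t‖ * ‖y t‖ + ‖x₁ t‖ * ‖y t - y₁ t‖ :=
              (norm_add_le _ _).trans (add_le_add (norm_mul_le _ _) (norm_mul_le _ _))
          _ ≤ ε / (2 * M) * M + N * (ε / (2 * N)) := by gcongr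
          _ = ε := by field_simp; norm_num
      smul_mem' := by
        intro c x hx t₀ ε hε
        obtain ⟨x', hx', h1⟩ := hx t₀ (ε / (‖c‖ + 1)) (by positivity)
        refine ⟨c • x', SMulMemClass.smul_mem c hx', ?_⟩
        filter_upwards [h1] with t h1
        rw [Pi.smul_apply, Pi.smul_apply, ← smul_sub, norm_smul]
        calc _ ≤ (‖c‖ + 1) * (ε / (‖c‖ + 1)) := by gcongr; linarith
          _ = ε := by field_simp
      star_mem' := by
        intro x hx t₀ ε hε
        obtain ⟨x', hx', h1⟩ := hx t₀ ε hε
        refine ⟨star x', star_mem hx', ?_⟩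
        filter_upwards [h1] with t h1
        rwa [Pi.star_apply, Pi.star_apply, ← star_sub, norm_star] }
  dense_eval := by
    intro t
    refine (U.dense_eval t).mono ?_
    rintro a ⟨x, hx, rfl⟩
    exact ⟨fun s => x s, fun t₀ ε hε => ⟨x, hx, by simp [hε.le]⟩, rfl⟩
  continuous_norm := by
    intro x hx
    refine continuous_norm_of_approx x fun t₀ ε hε => ?_
    obtain ⟨x', hx', h⟩ := hx t₀ ε hε
    exact ⟨fun t => x' t, (U.continuous_norm x' hx').comp continuous_subtype_val, h⟩
  mem_of_locally_approx := by
    intro x hx t₀ ε hε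
    obtain ⟨x', hx', h⟩ := hx t₀ (ε / 2) (by positivity)
    obtain ⟨x'', hx'', h'⟩ := hx' t₀ (ε / 2) (by positivity)
    refine ⟨x'', hx'', ?_⟩
    filter_upwards [h, h'] with t h h'
    have := norm_sub_le_norm_sub_add_norm_sub (x t) (x' t) (x'' t)
    linarith

/-- The constant field over `Ω` defined by `B`. -/
def const (Ω : Type u) [TopologicalSpace Ω] (B : Type v) [NonUnitalCStarAlgebra B] :
    ContinuousField Ω (fun _ : Ω => B) where
  Θ :=
    { carrier := {x | Continuous x}
      add_mem' := fun hx hy => Continuous.add hx hy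
      zero_mem' := continuous_const
      mul_mem' := fun hx hy => Continuous.mul hx hy
      smul_mem' := fun c _ hx => Continuous.const_smul hx c
      star_mem' := fun hx => Continuous.star hx }
  dense_eval := by
    intro t
    convert dense_univ
    ext a
    simp only [Set.mem_ofPred_eq, Set.mem_univ, iff_true]
    exact ⟨fun _ => a, continuous_const, rfl⟩
  continuous_norm := fun _ hx => Continuous.norm hx
  mem_of_locally_approx := by
    intro x hx
    refine continuous_iff_continuousAt.2 fun t₀ => Metric.continuousAt_iff'.2 fun ε hε => ?_
    obtain ⟨x', hx', h⟩ := hx t₀ (ε / 4) (by positivity)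
    have h1 := (Metric.continuousAt_iff'.1 (Continuous.continuousAt (x := t₀) hx')) (ε / 4) (by positivity)
    have h2 := h.self_of_nhds
    filter_upwards [h, h1] with t ht ht'
    rw [← dist_eq_norm] at ht h2
    have e1 := dist_triangle4 (x t) (x' t) (x' t₀) (x t₀)
    rw [dist_comm (x' t₀)] at e1
    linarith

/-- A field is trivial if it is isomorphic to a constant field. -/
def IsTrivial (U : ContinuousField Ω A) : Prop :=
  ∃ (B : Type v) (_ : NonUnitalCStarAlgebra B), Nonempty (Iso U (const Ω B))

/-- A field is locally trivial if every point has an open neighbourhood on which the induced field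
is trivial. -/
def IsLocallyTrivial (U : ContinuousField Ω A) : Prop :=
  ∀ t : Ω, ∃ V : Set Ω, IsOpen V ∧ t ∈ V ∧ (U.restrict V).IsTrivial

/-- A field is σ-locally trivial if its base has an open cover `W` such that all the induced fields
over the members of `W` are trivial, and a countable open cover `V` such that the closure of each
member of `V` lies in some member of `W`. -/
def IsSigmaLocallyTrivial (U : ContinuousField Ω A) : Prop :=
  ∃ (M : Type u) (W : M → Set Ω),
    (∀ μ, IsOpen (W μ)) ∧ (⋃ μ, W μ) = Set.univ ∧ (∀ μ, (U.restrict (W μ)).IsTrivial) ∧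
    ∃ (J : Type) (_ : Countable J) (V : J → Set Ω),
      (∀ j, IsOpen (V j)) ∧ (⋃ j, V j) = Set.univ ∧ ∀ j, ∃ μ, closure (V j) ⊆ W μ

end ContinuousField

/-- An element of a C⋆-algebra is strictly positive if it is positive and every nonzero positive
linear functional takes a strictly positive value at it. -/
def IsStrictlyPositiveElement {B : Type v} [NonUnitalCStarAlgebra B] (h : B) : Prop :=
  (∃ b : B, h = star b * b) ∧
    ∀ f : B →L[ℂ] ℂ, (∀ b : B, 0 ≤ (f (star b * b)).re ∧ (f (star b * b)).im = 0) → f ≠ 0 →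
      0 < (f h).re

namespace ContinuousField

variable {Ω : Type u} [TopologicalSpace Ω] {A : Ω → Type v} [∀ t, NonUnitalCStarAlgebra (A t)]

/-- All fibres of the field contain a strictly positive element. -/
def HasStrictlyPositiveElements (_U : ContinuousField Ω A) : Prop :=
  ∀ t, ∃ h : A t, IsStrictlyPositiveElement h

/-- `U` is a disjoint union of σ-locally trivial fields of C⋆-algebras with strictly positive
elements, namely of the fields that it induces on the members of a partition into open sets. -/
def IsDisjointUnionOfSigmaLocallyTrivial (U : ContinuousField Ω A) : Prop :=
  ∃ (M : Type u) (W : M → Set Ω),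
    (∀ μ, IsOpen (W μ)) ∧ (Pairwise fun μ ν => Disjoint (W μ) (W ν)) ∧ (⋃ μ, W μ) = Set.univ ∧
    ∀ μ, (U.restrict (W μ)).IsSigmaLocallyTrivial ∧ (U.restrict (W μ)).HasStrictlyPositiveElements

/-- The C⋆-algebra defined by `U`: the continuous vector fields whose norm vanishes at infinity, with
the supremum norm, realised inside the C⋆-algebra of all bounded vector fields. -/
noncomputable def sectionAlgebra (U : ContinuousField Ω A) : NonUnitalStarSubalgebra ℂ (lp A ∞) where
  carrier := {x | (fun t => x t) ∈ U.Θ ∧ Tendsto (fun t => ‖x t‖) (cocompact Ω) (𝓝 0)}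
  add_mem' := by
    rintro x y ⟨hx, hx'⟩ ⟨hy, hy'⟩
    refine ⟨add_mem hx hy, ?_⟩
    refine squeeze_zero (fun _ => norm_nonneg _) (fun t => norm_add_le (x t) (y t)) ?_
    simpa using hx'.add hy'
  zero_mem' := ⟨zero_mem U.Θ, by simpa using tendsto_const_nhds⟩
  mul_mem' := by
    rintro x y ⟨hx, hx'⟩ ⟨hy, hy'⟩
    refine ⟨mul_mem hx hy, ?_⟩
    refine squeeze_zero (fun _ => norm_nonneg _) (fun t => norm_mul_le (x t) (y t)) ?_
    simpa using hx'.mul hy'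
  smul_mem' := by
    rintro c x ⟨hx, hx'⟩
    refine ⟨SMulMemClass.smul_mem c hx, ?_⟩
    have : (fun t => ‖(c • x : lp A ∞) t‖) = fun t => ‖c‖ * ‖x t‖ := by
      funext t; rw [lp.coeFn_smul, Pi.smul_apply, norm_smul]
    rw [this]
    simpa using hx'.const_mul ‖c‖
  star_mem' := by
    rintro x ⟨hx, hx'⟩
    refine ⟨star_mem hx, ?_⟩
    have : (fun t => ‖(star x : lp A ∞) t‖) = fun t => ‖x t‖ := by
      funext t; rw [lp.coeFn_star, Pi.star_apply, norm_star]
    rw [this]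
    exact hx'

instance isClosed_sectionAlgebra (U : ContinuousField Ω A) :
    IsClosed (U.sectionAlgebra : Set (lp A ∞)) := by
  refine isClosed_of_closure_subset fun x hx => ?_
  rw [Metric.mem_closure_iff] at hx
  have key : ∀ ε : ℝ, 0 < ε → ∃ y : lp A ∞, y ∈ U.sectionAlgebra ∧ ∀ t, ‖x t - y t‖ ≤ ε := by
    intro ε hε
    obtain ⟨y, hy, hxy⟩ := hx ε hε
    refine ⟨y, hy, fun t => ?_⟩
    rw [dist_eq_norm] at hxy
    exact (lp.norm_apply_le_norm ENNReal.top_ne_zero (x - y) t).trans hxy.le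
  refine ⟨U.mem_of_locally_approx _ fun t ε hε => ?_, ?_⟩
  · obtain ⟨y, hy, h⟩ := key ε hε
    exact ⟨_, hy.1, Eventually.of_forall h⟩
  · rw [Metric.tendsto_nhds]
    intro ε hε
    obtain ⟨y, hy, h⟩ := key (ε / 2) (by positivity)
    have h1 := (Metric.tendsto_nhds.1 hy.2) (ε / 2) (by positivity)
    filter_upwards [h1] with t ht
    rw [dist_zero_right, norm_norm] at ht ⊢
    have := norm_le_norm_add_norm_sub' (x t) (y t)
    have := h t
    linarith

/-- Boundedness is no restriction: every continuous vector field whose norm vanishes at infinity is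
an element of the section algebra. -/
theorem exists_mem_sectionAlgebra (U : ContinuousField Ω A) (x : ∀ t, A t) (hx : x ∈ U.Θ)
    (h : Tendsto (fun t => ‖x t‖) (cocompact Ω) (𝓝 0)) :
    ∃ y ∈ U.sectionAlgebra, ∀ t, y t = x t := by
  have hc := U.continuous_norm x hx
  have hev : ∀ᶠ t in cocompact Ω, ‖x t‖ < 1 := h.eventually_lt_const one_pos
  obtain ⟨K, hK, hKs⟩ := mem_cocompact.1 hev
  obtain ⟨C, hC⟩ := hK.bddAbove_image hc.continuousOn
  have hb : Memℓp x ∞ := by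
    refine memℓp_infty ⟨max C 1, ?_⟩
    rintro _ ⟨t, rfl⟩
    by_cases ht : t ∈ K
    · exact (hC ⟨t, ht, rfl⟩).trans (le_max_left _ _)
    · exact (le_of_lt (hKs ht)).trans (le_max_right _ _)
  exact ⟨⟨x, hb⟩, ⟨hx, h⟩, fun _ => rfl⟩

end ContinuousField

end Fields

/-! ### Topological dimension -/

/-- `dim Ω ≤ n`: every locally finite open cover of `Ω` has a locally finite open refinement that
covers `Ω` and of which no more than `n + 1` members have a common point. -/
def TopologicalDimLE (Ω : Type u) [TopologicalSpace Ω] (n : ℕ) : Prop :=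
  ∀ (ι : Type u) (U : ι → Set Ω), (∀ i, IsOpen (U i)) → LocallyFinite U → (⋃ i, U i) = Set.univ →
    ∃ (κ : Type u) (V : κ → Set Ω), (∀ j, IsOpen (V j)) ∧ LocallyFinite V ∧
      (⋃ j, V j) = Set.univ ∧ (∀ j, ∃ i, V j ⊆ U i) ∧ ∀ t, {j | t ∈ V j}.encard ≤ n + 1

/-! ### Banach modules, projectivity, continuous Hochschild cohomology -/

section Modules

/-- A left Banach module structure on the Banach space `Y`: a bounded bilinear associative action. -/
structure LeftBanachModule (B : Type v) [NonUnitalNormedRing B] [NormedSpace ℂ B]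
    (Y : Type w) [NormedAddCommGroup Y] [NormedSpace ℂ Y] where
  /-- the left action -/
  act : B →L[ℂ] Y →L[ℂ] Y
  act_mul : ∀ a b y, act (a * b) y = act a (act b y)

/-- A Banach bimodule structure on the Banach space `X`; `ract a x` stands for `x · a`. -/
structure BanachBimodule (B : Type v) [NonUnitalNormedRing B] [NormedSpace ℂ B]
    (X : Type w) [NormedAddCommGroup X] [NormedSpace ℂ X] extends LeftBanachModule B X where
  /-- the right action -/
  ract : B →L[ℂ] X →L[ℂ] X
  ract_mul : ∀ a b x, ract (a * b) x = ract b (ract a x)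
  ract_act : ∀ a b x, ract b (act a x) = act a (ract b x)

/-- A Banach algebra `B` is left projective: every morphism of left Banach modules onto `B` that has
a bounded linear right inverse has a right inverse that is a morphism of left Banach modules. The
modules are taken from a universe at least as large as that of `B`. -/
def IsLeftProjective (B : Type v) [NonUnitalNormedRing B] [NormedSpace ℂ B] : Prop :=
  ∀ (Y : Type (max v w)) [NormedAddCommGroup Y] [NormedSpace ℂ Y] [CompleteSpace Y]
    (m : LeftBanachModule B Y) (φ : Y →L[ℂ] B), (∀ a y, φ (m.act a y) = a * φ y) →
    (∃ σ : B →L[ℂ] Y, ∀ b, φ (σ b) = b) →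
    ∃ ψ : B →L[ℂ] Y, (∀ a b, ψ (a * b) = m.act a (ψ b)) ∧ ∀ b, φ (ψ b) = b

namespace BanachBimodule

variable {B : Type v} [NonUnitalNormedRing B] [NormedSpace ℂ B]
  {X : Type w} [NormedAddCommGroup X] [NormedSpace ℂ X]

/-- A bimodule is right annihilator if `X · B = 0`. -/
def IsRightAnnihilator (m : BanachBimodule B X) : Prop :=
  ∀ a x, m.ract a x = 0

/-- The space of `n`-cochains: bounded `n`-linear maps from `B` to `X`. -/
abbrev Cochain (_m : BanachBimodule B X) (n : ℕ) : Type (max v w) :=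
  ContinuousMultilinearMap ℂ (fun _ : Fin n => B) X

/-- The Hochschild coboundary of `f`, as a function of `n + 1` variables:
`a₁ · f(a₂,…) + ∑ (-1)ⁱ f(…,aᵢaᵢ₊₁,…) + (-1)ⁿ⁺¹ f(a₁,…,aₙ) · aₙ₊₁`. -/
noncomputable def coboundary (m : BanachBimodule B X) (n : ℕ) :
    m.Cochain n →ₗ[ℂ] ((Fin (n + 1) → B) → X) where
  toFun f a := m.act (a 0) (f (Fin.tail a)) +
    ∑ i : Fin n, (-1 : ℂ) ^ ((i : ℕ) + 1) • f (Fin.contractNth i.castSucc (· * ·) a) +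
    (-1 : ℂ) ^ (n + 1) • m.ract (a (Fin.last n)) (f (Fin.init a))
  map_add' f g := by
    funext a
    simp only [add_apply, map_add, smul_add, Finset.sum_add_distrib,
      Pi.add_apply]
    abel
  map_smul' c f := by
    funext a
    simp only [smul_apply, map_smul, Pi.smul_apply, RingHom.id_apply,
      smul_add, Finset.smul_sum]
    simp only [smul_comm c]

/-- The space of `n`-cocycles. -/
noncomputable def cocycles (m : BanachBimodule B X) (n : ℕ) : Submodule ℂ (m.Cochain n) :=
  LinearMap.ker (m.coboundary n)

/-- The cochains of degree `n + 1` that are the coboundary of an `n`-cochain. -/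
noncomputable def coboundariesSucc (m : BanachBimodule B X) (n : ℕ) :
    Submodule ℂ (m.Cochain (n + 1)) where
  carrier := {g | ∃ f : m.Cochain n, m.coboundary n f = g}
  add_mem' := by
    rintro g g' ⟨f, hf⟩ ⟨f', hf'⟩
    exact ⟨f + f', by rw [map_add, hf, hf']; rfl⟩
  zero_mem' := ⟨0, by rw [map_zero]; rfl⟩
  smul_mem' := by
    rintro c g ⟨f, hf⟩
    exact ⟨c • f, by rw [map_smul, hf]; rfl⟩

/-- The space of `n`-coboundaries. -/
noncomputable def coboundaries (m : BanachBimodule B X) : ∀ n : ℕ, Submodule ℂ (m.Cochain n)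
  | 0 => ⊥
  | n + 1 => m.coboundariesSucc n

/-- The `n`-th continuous Hochschild cohomology group: cocycles modulo coboundaries. -/
abbrev Cohomology (m : BanachBimodule B X) (n : ℕ) : Type (max v w) :=
  m.cocycles n ⧸ (m.coboundaries n).submoduleOf (m.cocycles n)

end BanachBimodule

end Modules

/-!
A family `(uᵢ)` in a Banach algebra `B` with `∑ b uᵢ² = b`, bounded signed sums and few non-zero
products `uᵢ uⱼ` makes `B` left projective: averaging over signs bounds the diagonal sums `∑ β(b
uᵢ, uᵢ)` of a bounded bilinear map, so a linear section `σ` of a module morphism can be replaced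
by `b ↦ ∑ (b uᵢ) · σ(uᵢ)`. By the Hahn–Banach theorem a strictly positive element `h` of a
C⋆-algebra satisfies `a⋆ a ≤ t h + e` with `e` small, hence its functional calculus contains an
approximate unit; the square roots of the increments of that unit form such a family. When `Ω` is
paracompact it is a disjoint union of open σ-compact sets, each of which carries a section with
strictly positive values.

Conversely, over an open set `V` that trivialises the field, left projectivity splits the
restriction of functions of two variables to the diagonal. This provides a continuous map `k` from
`V` to the bounded functions on `V` such that `‖k s s‖` is bounded below while `k s` vanishes at
infinity. A locally finite refinement of a cover of the range of `k` by small balls pulls back to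
a locally finite cover of `V` by relatively compact sets. Countably many of these covers exhaust
each σ-locally trivial summand, so a member meets only countably many others, and the chains of
overlapping members partition `Ω` into open σ-compact sets.

Finally, a `2`-cocycle with values in a right annihilator bimodule `X` defines an extension of the
algebra by `X` as a left module; a module splitting of it is, up to sign, a primitive of the
cocycle.
-/

/-! ### Almost orthogonal units -/

section Averaging

variable {𝕜 ι E F G : Type*} [RCLike 𝕜] [NormedAddCommGroup E] [NormedSpace 𝕜 E]
  [NormedAddCommGroup F] [NormedSpace 𝕜 F] [NormedAddCommGroup G] [NormedSpace 𝕜 G]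

theorem norm_add_signedSum_le_of_insert [DecidableEq ι] {s : Finset ι} {j : ι} (hj : j ∉ s)
    {z : ι → G} {z₀ : G} {C : ℝ}
    (h : ∀ ε : ι → ℤˣ, ‖z₀ + ∑ i ∈ insert j s, ε i • z i‖ ≤ C) (η : ℤˣ) (ε : ι → ℤˣ) :
    ‖(z₀ + η • z j) + ∑ i ∈ s, ε i • z i‖ ≤ C := by
  have hη := h (Function.update ε j η)
  rw [Finset.sum_insert hj, ← add_assoc, Function.update_self] at hη
  refine le_of_eq_of_le ?_ hη
  congr 2
  refine Finset.sum_congr rfl fun i hi => ?_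
  rw [Function.update_of_ne (ne_of_mem_of_not_mem hi hj)]

theorem bilin_add_add_bilin_sub (β : E →L[𝕜] F →L[𝕜] G) (x₀ x : E) (y₀ y : F) :
    β (x₀ + x) (y₀ + y) + β (x₀ - x) (y₀ - y) = (2 : 𝕜) • (β x₀ y₀ + β x y) := by
  simp only [map_add, map_sub, add_apply, sub_apply]
  module

/-- Averaging over the sign of the last term removes the mixed terms of
`β (x₀ + ∑ ± xᵢ) (y₀ + ∑ ± yᵢ)` one index at a time. -/
theorem norm_bilin_add_sum_le (β : E →L[𝕜] F →L[𝕜] G) {x : ι → E} {y : ι → F} {C D : ℝ}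
    (s : Finset ι) {x₀ : E} {y₀ : F}
    (hx : ∀ ε : ι → ℤˣ, ‖x₀ + ∑ i ∈ s, ε i • x i‖ ≤ C)
    (hy : ∀ ε : ι → ℤˣ, ‖y₀ + ∑ i ∈ s, ε i • y i‖ ≤ D) :
    ‖β x₀ y₀ + ∑ i ∈ s, β (x i) (y i)‖ ≤ ‖β‖ * C * D := by
  classical
  induction s using Finset.induction_on generalizing x₀ y₀ with
  | empty =>
    simp only [Finset.sum_empty, add_zero, forall_const] at hx hy ⊢
    exact β.le_of_opNorm₂_le_of_le le_rfl hx hy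
  | insert j s hj ih =>
    have signed (η : ℤˣ) := ih (norm_add_signedSum_le_of_insert hj hx η)
      (norm_add_signedSum_le_of_insert hj hy η)
    have plus := signed 1
    have minus := signed (-1)
    rw [one_smul, one_smul] at plus
    rw [Units.neg_smul, Units.neg_smul, one_smul, one_smul, ← sub_eq_add_neg,
      ← sub_eq_add_neg] at minus
    have average : (2 : 𝕜) • (β x₀ y₀ + ∑ i ∈ insert j s, β (x i) (y i)) =
        (β (x₀ + x j) (y₀ + y j) + ∑ i ∈ s, β (x i) (y i)) +
          (β (x₀ - x j) (y₀ - y j) + ∑ i ∈ s, β (x i) (y i)) := by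
      rw [Finset.sum_insert hj, add_add_add_comm, bilin_add_add_bilin_sub]
      module
    have h := norm_add_le_of_le plus minus
    rw [← average, norm_smul, RCLike.norm_ofNat] at h
    linarith

end Averaging

section LeftProjective

variable {B : Type v} [NonUnitalNormedRing B] [NormedSpace ℂ B]

/-- A family `u` in a Banach algebra of which every member annihilates all but finitely many
members from the left, with `∑ b uᵢ² = b` for all `b` and signed finite sums bounded by `C`. -/
structure IsAlmostOrthogonalUnit {ι : Type*} (u : ι → B) (C : ℝ) : Prop where
  norm_signedSum_le : ∀ (s : Finset ι) (ε : ι → ℤˣ), ‖∑ i ∈ s, ε i • u i‖ ≤ C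
  finite_mul_ne_zero : ∀ i, {j | u i * u j ≠ 0}.Finite
  hasSum_mul_mul : ∀ b, HasSum (fun i => b * u i * u i) b

namespace IsAlmostOrthogonalUnit

variable {ι : Type*} {u : ι → B} {C : ℝ}
  {Y : Type*} [NormedAddCommGroup Y] [NormedSpace ℂ Y]

theorem norm_sum_bilin_le (hu : IsAlmostOrthogonalUnit u C) (β : B →L[ℂ] B →L[ℂ] Y)
    (s : Finset ι) (b : B) : ‖∑ i ∈ s, β (b * u i) (u i)‖ ≤ ‖β‖ * C * C * ‖b‖ := by
  have hb (ε : ι → ℤˣ) : ‖0 + ∑ i ∈ s, ε i • (b * u i)‖ ≤ ‖b‖ * C := by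
    simp_rw [zero_add, ← mul_smul_comm, ← Finset.mul_sum]
    exact norm_mul_le_of_le le_rfl (hu.norm_signedSum_le s ε)
  have h := norm_bilin_add_sum_le β s (y₀ := 0) hb
    (fun ε => by rw [zero_add]; exact hu.norm_signedSum_le s ε)
  rw [map_zero, zero_add] at h
  linarith

theorem summable_bilin [CompleteSpace Y] (hu : IsAlmostOrthogonalUnit u C)
    (β : B →L[ℂ] B →L[ℂ] Y) (b : B) : Summable fun i => β (b * u i) (u i) := by
  classical
  rw [summable_iff_vanishing_norm]
  intro δ hδ
  obtain ⟨K, hK⟩ : ∃ K, K = ‖β‖ * C * C + 1 := ⟨_, rfl⟩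
  have hC : 0 ≤ C := (norm_nonneg _).trans (hu.norm_signedSum_le ∅ 1)
  have hK0 : 0 < K := hK ▸ by positivity
  obtain ⟨s, hs⟩ := (Metric.tendsto_nhds.1 (hu.hasSum_mul_mul b) (δ / K) (by positivity)).exists
  obtain ⟨e, he⟩ : ∃ e, e = ∑ i ∈ s, b * u i * u i := ⟨_, rfl⟩
  rw [← he, dist_comm, dist_eq_norm, lt_div_iff₀' hK0] at hs
  refine ⟨s.biUnion fun j => (hu.finite_mul_ne_zero j).toFinset, fun t ht => ?_⟩
  have he0 : ∀ i ∈ t, e * u i = 0 := by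
    intro i hi
    rw [he, Finset.sum_mul]
    refine Finset.sum_eq_zero fun j hj => ?_
    have hji : u j * u i = 0 := by
      by_contra hne
      exact Finset.disjoint_left.1 ht hi (Finset.mem_biUnion.2 ⟨j, hj, by simpa using hne⟩)
    rw [mul_assoc, hji, mul_zero]
  calc ‖∑ i ∈ t, β (b * u i) (u i)‖ = ‖∑ i ∈ t, β ((b - e) * u i) (u i)‖ := by
        refine congrArg norm (Finset.sum_congr rfl fun i hi => ?_)
        rw [sub_mul, he0 i hi, sub_zero]
    _ ≤ ‖β‖ * C * C * ‖b - e‖ := hu.norm_sum_bilin_le β t _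
    _ ≤ K * ‖b - e‖ := by gcongr; linarith
    _ < δ := hs

variable [IsScalarTower ℂ B B]

/-- The bounded linear map `b ↦ ∑ β(b uᵢ, uᵢ)`. -/
noncomputable def diagonalSum [CompleteSpace Y] (hu : IsAlmostOrthogonalUnit u C)
    (β : B →L[ℂ] B →L[ℂ] Y) : B →L[ℂ] Y :=
  LinearMap.mkContinuous
    { toFun := fun b => ∑' i, β (b * u i) (u i)
      map_add' := fun a b => by
        simp only [add_mul, map_add, add_apply]
        exact (hu.summable_bilin β a).tsum_add (hu.summable_bilin β b)
      map_smul' := fun c b => by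
        simp only [smul_mul_assoc, map_smul, smul_apply, RingHom.id_apply]
        exact (hu.summable_bilin β b).tsum_const_smul c }
    (‖β‖ * C * C) fun b => le_of_tendsto (hu.summable_bilin β b).hasSum.norm
      (Eventually.of_forall fun s => hu.norm_sum_bilin_le β s b)

theorem diagonalSum_apply [CompleteSpace Y] (hu : IsAlmostOrthogonalUnit u C)
    (β : B →L[ℂ] B →L[ℂ] Y) (b : B) : hu.diagonalSum β b = ∑' i, β (b * u i) (u i) :=
  rfl

/-- If `σ` is a linear section of a module morphism, then `b ↦ ∑ (b uᵢ) · σ(uᵢ)` is a section that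
is a module morphism. -/
theorem isLeftProjective (hu : IsAlmostOrthogonalUnit u C) : IsLeftProjective.{v, w} B := by
  rintro Y _ _ _ m φ hφ ⟨σ, hσ⟩
  let β : B →L[ℂ] B →L[ℂ] Y := m.act.bilinearComp (ContinuousLinearMap.id ℂ B) σ
  have hβ : ∀ a b, β a b = m.act a (σ b) := fun _ _ => rfl
  refine ⟨hu.diagonalSum β, fun a b => ?_, fun b => ?_⟩
  · rw [hu.diagonalSum_apply, hu.diagonalSum_apply, (m.act a).map_tsum (hu.summable_bilin β b)]
    simp only [hβ, mul_assoc a, m.act_mul]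
  · rw [hu.diagonalSum_apply, φ.map_tsum (hu.summable_bilin β b)]
    simp only [hβ, hφ, hσ]
    exact (hu.hasSum_mul_mul b).tsum_eq

end IsAlmostOrthogonalUnit

namespace LeftBanachModule

variable {Y Z : Type*} [NormedAddCommGroup Y] [NormedSpace ℂ Y] [NormedAddCommGroup Z]
  [NormedSpace ℂ Z]

/-- Transport of a left Banach module structure along an isomorphism of Banach spaces. -/
noncomputable def transport (m : LeftBanachModule B Y) (e : Y ≃L[ℂ] Z) : LeftBanachModule B Z where
  act := (e.arrowCongr e : (Y →L[ℂ] Y) ≃L[ℂ] Z →L[ℂ] Z).toContinuousLinearMap.comp m.act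
  act_mul a b z := by simp [m.act_mul]

end LeftBanachModule

/-- `IsLeftProjective.{v, w}` quantifies over modules in `Type (max v w)`; the splitting property
descends to those in `Type v`. -/
theorem IsLeftProjective.exists_splitting (h : IsLeftProjective.{v, w} B) {Y : Type v}
    [NormedAddCommGroup Y] [NormedSpace ℂ Y] [CompleteSpace Y] (m : LeftBanachModule B Y)
    (φ : Y →L[ℂ] B) (hφ : ∀ a y, φ (m.act a y) = a * φ y) (σ : B →L[ℂ] Y)
    (hσ : ∀ b, φ (σ b) = b) :
    ∃ ψ : B →L[ℂ] Y, (∀ a b, ψ (a * b) = m.act a (ψ b)) ∧ ∀ b, φ (ψ b) = b := by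
  let e : Y ≃L[ℂ] ULift.{w} Y := ContinuousLinearEquiv.ulift.symm
  obtain ⟨ψ, hψ, hφψ⟩ := h (ULift.{w} Y) (m.transport e) (φ.comp e.symm.toContinuousLinearMap)
    (fun a y => hφ a y.down) ⟨e.toContinuousLinearMap.comp σ, hσ⟩
  exact ⟨e.symm.toContinuousLinearMap.comp ψ, fun a b => congrArg ULift.down (hψ a b), hφψ⟩

end LeftProjective

/-! ### Cohomology in degree two -/

section Cohomology

variable {B : Type v} [NonUnitalNormedRing B] [NormedSpace ℂ B]
  {X : Type w} [NormedAddCommGroup X] [NormedSpace ℂ X]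

namespace BanachBimodule

/-- A `2`-cochain as a bounded bilinear map. -/
noncomputable def cochainTwoEquiv (m : BanachBimodule B X) : m.Cochain 2 ≃L[ℂ] B →L[ℂ] B →L[ℂ] X :=
  (continuousMultilinearCurryLeftEquiv ℂ (fun _ : Fin 2 => B) X).toContinuousLinearEquiv.trans
    ((ContinuousLinearEquiv.refl ℂ B).arrowCongr
      (continuousMultilinearCurryFin1 ℂ B X).toContinuousLinearEquiv)

theorem cochainTwoEquiv_apply (m : BanachBimodule B X) (f : m.Cochain 2) (a : Fin 2 → B) :
    f a = m.cochainTwoEquiv f (a 0) (a 1) := by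
  change f a = f (Fin.cons (a 0) (Fin.snoc 0 (a 1)))
  congr 1
  ext i
  fin_cases i <;> rfl

variable {m : BanachBimodule B X}

theorem IsRightAnnihilator.act_sub_add_eq_zero_of_mem_cocycles (hm : m.IsRightAnnihilator)
    {f : m.Cochain 2} (hf : f ∈ m.cocycles 2) (a b c : B) :
    m.act a (m.cochainTwoEquiv f b c) - m.cochainTwoEquiv f (a * b) c +
      m.cochainTwoEquiv f a (b * c) = 0 := by
  have h := congrFun (LinearMap.mem_ker.1 hf) ![a, b, c]
  simp only [coboundary, LinearMap.coe_mk, AddHom.coe_mk, hm _ _, smul_zero, add_zero,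
    Fin.sum_univ_two, cochainTwoEquiv_apply] at h
  simpa [Fin.tail, Fin.contractNth, sub_eq_add_neg, add_assoc] using h

theorem IsRightAnnihilator.coboundary_one_apply (hm : m.IsRightAnnihilator) (g : B →L[ℂ] X)
    (a : Fin 2 → B) :
    m.coboundary 1 ((continuousMultilinearCurryFin1 ℂ B X).symm g) a =
      m.act (a 0) (g (a 1)) - g (a 0 * a 1) := by
  simp only [coboundary, LinearMap.coe_mk, AddHom.coe_mk, hm _ _, smul_zero, add_zero,
    Finset.univ_unique, Finset.sum_singleton]
  simp [Fin.tail, Fin.contractNth, sub_eq_add_neg]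

end BanachBimodule

variable [IsScalarTower ℂ B B] [SMulCommClass ℂ B B]

/-- The extension of `B` by the left module `X` defined by the cocycle `f`, with the action
`a · (x, b) = (a · x + f(a, b), ab)`. -/
noncomputable def LeftBanachModule.extension (m : LeftBanachModule B X) (f : B →L[ℂ] B →L[ℂ] X)
    (hf : ∀ a b c, m.act a (f b c) - f (a * b) c + f a (b * c) = 0) :
    LeftBanachModule B (X × B) where
  act := (ContinuousLinearMap.prodₗᵢ ℂ).toContinuousLinearEquiv.toContinuousLinearMap.comp
    ((m.act.bilinearComp (.id ℂ B) (.fst ℂ X B) + f.bilinearComp (.id ℂ B) (.snd ℂ X B)).prod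
      ((ContinuousLinearMap.mul ℂ B).bilinearComp (.id ℂ B) (.snd ℂ X B)))
  act_mul a b y := by
    have h : f (a * b) y.2 = m.act a (f b y.2) + f a (b * y.2) := by
      rw [← sub_eq_zero, ← neg_eq_zero, ← hf a b y.2]
      abel
    refine Prod.ext ?_ (mul_assoc a b y.2)
    change m.act (a * b) y.1 + f (a * b) y.2 = m.act a (m.act b y.1 + f b y.2) + f a (b * y.2)
    rw [h, m.act_mul, map_add, add_assoc]

theorem LeftBanachModule.extension_act (m : LeftBanachModule B X) (f : B →L[ℂ] B →L[ℂ] X)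
    (hf : ∀ a b c, m.act a (f b c) - f (a * b) c + f a (b * c) = 0) (a : B) (y : X × B) :
    (m.extension f hf).act a y = (m.act a y.1 + f a y.2, a * y.2) :=
  rfl

/-- A morphism splitting the extension of `B` by `X` that a `2`-cocycle defines has the negative of
a primitive of the cocycle as its first component. -/
theorem IsLeftProjective.subsingleton_cohomology_two [CompleteSpace B]
    (h : IsLeftProjective.{v, w} B) {X : Type (max v w)} [NormedAddCommGroup X] [NormedSpace ℂ X]
    [CompleteSpace X] {m : BanachBimodule B X} (hm : m.IsRightAnnihilator) :
    Subsingleton (m.Cohomology 2) := by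
  rw [Submodule.Quotient.subsingleton_iff, Submodule.submoduleOf_eq_top]
  intro f hf
  let extension := m.extension (m.cochainTwoEquiv f) (hm.act_sub_add_eq_zero_of_mem_cocycles hf)
  obtain ⟨ψ, hψ, hψ_snd⟩ := h (X × B) extension (ContinuousLinearMap.snd ℂ X B)
    (fun _ _ => rfl) ⟨ContinuousLinearMap.inr ℂ X B, fun _ => rfl⟩
  have hψ_snd : ∀ b, (ψ b).2 = b := hψ_snd
  refine ⟨(continuousMultilinearCurryFin1 ℂ B X).symm (-(ContinuousLinearMap.fst ℂ X B).comp ψ),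
    funext fun a => ?_⟩
  have hψ_fst : (ψ (a 0 * a 1)).1 = m.act (a 0) (ψ (a 1)).1 + m.cochainTwoEquiv f (a 0) (a 1) := by
    rw [hψ, LeftBanachModule.extension_act, hψ_snd]
  rw [hm.coboundary_one_apply, m.cochainTwoEquiv_apply]
  simp [hψ_fst]

end Cohomology

/-! ### Partitions into open σ-compact sets -/

section Partition

theorem countable_reflTransGen {ι : Type*} {r : ι → ι → Prop}
    (hr : ∀ i, {j | r i j}.Countable) (i : ι) : {j | Relation.ReflTransGen r i j}.Countable := by
  let sphere : ℕ → Set ι := fun n => Nat.rec {i} (fun _ S => ⋃ k ∈ S, {j | r k j}) n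
  have countable_sphere (n : ℕ) : (sphere n).Countable := by
    induction n with
    | zero => exact Set.countable_singleton i
    | succ n ih => exact ih.biUnion fun k _ => hr k
  refine (Set.countable_iUnion countable_sphere).mono fun j hj => Set.mem_iUnion.2 ?_
  induction hj with
  | refl => exact ⟨0, rfl⟩
  | tail _ hjk ih =>
    obtain ⟨n, hn⟩ := ih
    exact ⟨n + 1, Set.mem_biUnion hn hjk⟩

variable {Ω : Type*} [TopologicalSpace Ω]

/-- A partition of a space into open sets, some of which may be empty. -/
structure IsOpenPartition {M : Type*} (W : M → Set Ω) : Prop where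
  isOpen : ∀ μ, IsOpen (W μ)
  disjoint : Pairwise fun μ ν => Disjoint (W μ) (W ν)
  iUnion_eq : (⋃ μ, W μ) = Set.univ

/-- A partition of a space into open σ-compact sets. -/
structure IsSigmaCompactPartition {M : Type*} (W : M → Set Ω) : Prop extends
    IsOpenPartition W where
  isSigmaCompact : ∀ μ, IsSigmaCompact (W μ)

namespace IsOpenPartition

variable {M : Type*} {W : M → Set Ω}

theorem exists_mem (hW : IsOpenPartition W) (t : Ω) : ∃ μ, t ∈ W μ :=
  Set.iUnion_eq_univ_iff.1 hW.iUnion_eq t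

theorem eq_of_mem (hW : IsOpenPartition W) {μ ν : M} {t : Ω} (hμ : t ∈ W μ) (hν : t ∈ W ν) :
    μ = ν :=
  not_imp_comm.1 (@hW.disjoint μ ν) (Set.not_disjoint_iff.2 ⟨t, hμ, hν⟩)

theorem isClosed (hW : IsOpenPartition W) (μ : M) : IsClosed (W μ) := by
  have hcompl : (W μ)ᶜ = ⋃ (ν) (_ : ν ≠ μ), W ν := by
    ext t
    obtain ⟨ν, hν⟩ := hW.exists_mem t
    simp only [Set.mem_compl_iff, Set.mem_iUnion, exists_prop]
    exact ⟨fun ht => ⟨ν, fun h => ht (h ▸ hν), hν⟩,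
      fun ⟨_, hne, hν⟩ hμ => hne (hW.eq_of_mem hν hμ)⟩
  rw [← isOpen_compl_iff, hcompl]
  exact isOpen_biUnion fun ν _ => hW.isOpen ν

theorem paracompactSpace (hW : IsOpenPartition W) (h : ∀ μ, ParacompactSpace (W μ)) :
    ParacompactSpace Ω := by
  refine ⟨fun α s hs hsu => ?_⟩
  have hsu (μ : M) : (⋃ a, ((↑) : W μ → Ω) ⁻¹' s a) = Set.univ := by
    rw [← Set.preimage_iUnion, hsu, Set.preimage_univ]
  choose v hvo hvu hvf hvs using fun μ =>
    precise_refinement _ (fun a => (hs a).preimage continuous_subtype_val) (hsu μ)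
  have mem_iff {μ : M} (t : W μ) (a : α) : (t : Ω) ∈ ⋃ ν, (↑) '' v ν a ↔ t ∈ v μ a := by
    refine ⟨fun ht => ?_, fun ht => Set.mem_iUnion.2 ⟨μ, t, ht, rfl⟩⟩
    obtain ⟨ν, t', ht', h⟩ := Set.mem_iUnion.1 ht
    obtain rfl := hW.eq_of_mem t.2 (h ▸ t'.2)
    rwa [← Subtype.ext h]
  refine ⟨α, fun a => ⋃ μ, (↑) '' v μ a, fun a => ?_, ?_, fun t => ?_, fun a => ⟨a, ?_⟩⟩
  · exact isOpen_iUnion fun μ => (hW.isOpen μ).isOpenMap_subtype_val _ (hvo μ a)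
  · refine Set.iUnion_eq_univ_iff.2 fun t => ?_
    obtain ⟨μ, hμ⟩ := hW.exists_mem t
    obtain ⟨a, ha⟩ := Set.iUnion_eq_univ_iff.1 (hvu μ) ⟨t, hμ⟩
    exact ⟨a, (mem_iff ⟨t, hμ⟩ a).2 ha⟩
  · obtain ⟨μ, hμ⟩ := hW.exists_mem t
    obtain ⟨N, hN, hfin⟩ := hvf μ ⟨t, hμ⟩
    refine ⟨(↑) '' N, (hW.isOpen μ).isOpenMap_subtype_val.image_mem_nhds hN, hfin.subset ?_⟩
    rintro a ⟨_, ha, t', ht', rfl⟩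
    exact ⟨t', (mem_iff t' a).1 ha, ht'⟩
  · exact Set.iUnion_subset fun μ => Set.image_subset_iff.2 (hvs μ a)

end IsOpenPartition

theorem IsSigmaCompactPartition.paracompactSpace [T2Space Ω] [LocallyCompactSpace Ω] {M : Type*}
    {W : M → Set Ω} (hW : IsSigmaCompactPartition W) : ParacompactSpace Ω :=
  hW.toIsOpenPartition.paracompactSpace fun μ =>
    have := isSigmaCompact_iff_sigmaCompactSpace.1 (hW.isSigmaCompact μ)
    have := (hW.isOpen μ).locallyCompactSpace
    inferInstance

section Chains

variable {ι : Type u}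

/-- Two indices are equivalent if they are joined by a chain of consecutively overlapping members
of the family `C`. -/
def chainSetoid (C : ι → Set Ω) : Setoid ι where
  r := Relation.ReflTransGen fun i j => (C i ∩ C j).Nonempty
  iseqv :=
    have : Std.Symm fun i j => (C i ∩ C j).Nonempty :=
      ⟨fun i j h => Set.inter_comm (C i) (C j) ▸ h⟩
    ⟨fun _ => .refl, fun {i j} h => Relation.ReflTransGen.stdSymm.symm i j h, .trans⟩

/-- The union of a class of `chainSetoid C`. -/
def chainComponent (C : ι → Set Ω) (q : Quotient (chainSetoid C)) : Set Ω :=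
  ⋃ (i) (_ : Quotient.mk _ i = q), C i

theorem isOpenPartition_chainComponent {C : ι → Set Ω} (ho : ∀ i, IsOpen (C i))
    (hu : (⋃ i, C i) = Set.univ) : IsOpenPartition (chainComponent C) where
  isOpen _ := isOpen_biUnion fun i _ => ho i
  disjoint := by
    intro p q hpq
    refine Set.disjoint_left.2 fun t hp hq => ?_
    obtain ⟨i, rfl, hi⟩ := Set.mem_iUnion₂.1 hp
    obtain ⟨j, rfl, hj⟩ := Set.mem_iUnion₂.1 hq
    exact hpq (Quotient.sound (.single ⟨t, hi, hj⟩))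
  iUnion_eq := Set.iUnion_eq_univ_iff.2 fun t =>
    have ⟨i, hi⟩ := Set.iUnion_eq_univ_iff.1 hu t
    ⟨Quotient.mk _ i, Set.mem_biUnion rfl hi⟩

theorem isSigmaCompactPartition_chainComponent {C : ι → Set Ω} (ho : ∀ i, IsOpen (C i))
    (hu : (⋃ i, C i) = Set.univ) (hc : ∀ i, IsCompact (closure (C i)))
    (hr : ∀ i, {j | (C i ∩ C j).Nonempty}.Countable) :
    IsSigmaCompactPartition (chainComponent C) where
  __ := isOpenPartition_chainComponent ho hu
  isSigmaCompact q := by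
    have hclosure : chainComponent C q = ⋃ i : {i // Quotient.mk _ i = q}, closure (C i) := by
      rw [chainComponent, Set.iUnion_subtype]
      refine subset_antisymm (Set.iUnion₂_mono fun i _ => subset_closure) (Set.iUnion₂_subset ?_)
      exact fun i hi => closure_minimal (Set.subset_biUnion_of_mem (u := C) hi)
        ((isOpenPartition_chainComponent ho hu).isClosed q)
    have : Countable {i // Quotient.mk (chainSetoid C) i = q} := by
      induction q using Quotient.inductionOn with
      | h i =>
        exact ((countable_reflTransGen hr i).mono fun j hj =>
          (chainSetoid C).symm' (Quotient.exact hj)).to_subtype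
    rw [hclosure]
    exact isSigmaCompact_iUnion_of_isCompact _ fun i => hc i

end Chains

theorem exists_isSigmaCompactPartition (Ω : Type u) [TopologicalSpace Ω] [T2Space Ω]
    [LocallyCompactSpace Ω] [ParacompactSpace Ω] :
    ∃ (M : Type u) (W : M → Set Ω), IsSigmaCompactPartition W := by
  choose K hK hKt using fun t : Ω => exists_compact_mem_nhds t
  obtain ⟨v, hvo, hvu, hvf, hvK⟩ := precise_refinement (fun t => interior (K t))
    (fun _ => isOpen_interior)
    (Set.iUnion_eq_univ_iff.2 fun t => ⟨t, mem_interior_iff_mem_nhds.2 (hKt t)⟩)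
  have hc (t : Ω) : IsCompact (closure (v t)) :=
    (hK t).closure_of_subset ((hvK t).trans interior_subset)
  refine ⟨_, _, isSigmaCompactPartition_chainComponent hvo hvu hc fun i => ?_⟩
  refine ((hvf.finite_nonempty_inter_compact (hc i)).subset ?_).countable
  rintro j ⟨t, hi, hj⟩
  exact ⟨t, hj, subset_closure hi⟩

end Partition

/-! ### Continuous vector fields -/

theorem exists_continuousMap_eventuallyEq_one {X : Type*} [TopologicalSpace X] [R1Space X]
    [LocallyCompactSpace X] {O : Set X} (hO : IsOpen O) {t : X} (ht : t ∈ O) :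
    ∃ g : C(X, ℝ), (∀ᶠ s in 𝓝 t, g s = 1) ∧ HasCompactSupport g ∧ tsupport g ⊆ O := by
  obtain ⟨K, hK, htK, hKO⟩ := exists_compact_subset hO ht
  obtain ⟨g, hg, hgc, hgO, -⟩ := exists_continuousMap_one_of_isCompact_subset_isOpen hK hO hKO
  exact ⟨g, eventually_of_mem (mem_interior_iff_mem_nhds.1 htK) fun _ hs => hg hs, hgc, hgO⟩

namespace ContinuousField

variable {Ω : Type u} [TopologicalSpace Ω] {A : Ω → Type v} [∀ t, NonUnitalCStarAlgebra (A t)]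

section Evaluation

/-- The value of sections at a point, as a homomorphism of C⋆-algebras. -/
def evalHom (U : ContinuousField Ω A) (t : Ω) : U.sectionAlgebra →⋆ₙₐ[ℂ] A t where
  toFun x := (x : lp A ∞) t
  map_smul' _ _ := rfl
  map_zero' := rfl
  map_add' _ _ := rfl
  map_mul' _ _ := rfl
  map_star' _ := rfl

variable {U : ContinuousField Ω A} {x y : U.sectionAlgebra}

theorem norm_evalHom_le (t : Ω) (x : U.sectionAlgebra) : ‖U.evalHom t x‖ ≤ ‖x‖ :=
  lp.norm_apply_le_norm ENNReal.top_ne_zero (x : lp A ∞) t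

theorem continuous_evalHom (U : ContinuousField Ω A) (t : Ω) : Continuous (U.evalHom t) :=
  AddMonoidHomClass.continuous_of_bound (U.evalHom t) 1 fun x =>
    (norm_evalHom_le t x).trans_eq (one_mul _).symm

theorem evalHom_mem (x : U.sectionAlgebra) : (fun t => U.evalHom t x) ∈ U.Θ :=
  x.2.1

theorem tendsto_norm_evalHom (x : U.sectionAlgebra) :
    Tendsto (fun t => ‖U.evalHom t x‖) (cocompact Ω) (𝓝 0) :=
  x.2.2

theorem ext_evalHom (h : ∀ t, U.evalHom t x = U.evalHom t y) : x = y :=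
  Subtype.ext (lp.ext (funext h))

theorem norm_le_of_forall_norm_evalHom_le {C : ℝ} (hC : 0 ≤ C) (h : ∀ t, ‖U.evalHom t x‖ ≤ C) :
    ‖x‖ ≤ C :=
  lp.norm_le_of_forall_le hC h

end Evaluation

section Along

variable {T : Type*} [TopologicalSpace T]

/-- Continuity of a vector field along a map `j : T → Ω`: local approximability by continuous vector
fields of `U`. For the inclusion of a subset this is continuity for the induced field. -/
def IsContinuousAlong (U : ContinuousField Ω A) (j : T → Ω) (y : ∀ t, A (j t)) : Prop :=
  ∀ t₀, ∀ ε : ℝ, 0 < ε → ∃ x ∈ U.Θ, ∀ᶠ t in 𝓝 t₀, ‖y t - x (j t)‖ ≤ ε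

theorem mem_restrict {U : ContinuousField Ω A} {V : Set Ω} {y : ∀ t : V, A t} :
    y ∈ (U.restrict V).Θ ↔ U.IsContinuousAlong (fun t : V => (t : Ω)) y :=
  Iff.rfl

theorem restrict_mem {U : ContinuousField Ω A} (V : Set Ω) {x : ∀ t, A t} (hx : x ∈ U.Θ) :
    (fun t : V => x t) ∈ (U.restrict V).Θ :=
  fun _ _ hε => ⟨x, hx, .of_forall fun _ => by simpa only [sub_self, norm_zero] using hε.le⟩

theorem Iso.norm_φ {A' : Ω → Type v} [∀ t, NonUnitalCStarAlgebra (A' t)]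
    {U : ContinuousField Ω A} {U' : ContinuousField Ω A'} (e : Iso U U') (t : Ω) (a : A t) :
    ‖e.φ t a‖ = ‖a‖ :=
  NonUnitalStarAlgHom.norm_map (e.φ t) (e.φ t).injective a

theorem isContinuousAlong_restrict_iff {U : ContinuousField Ω A} {W : Set Ω} {j : T → W}
    (hj : Continuous j) {y : ∀ t, A (j t)} :
    (U.restrict W).IsContinuousAlong j y ↔ U.IsContinuousAlong (fun t => (j t : Ω)) y := by
  constructor
  · intro h t₀ ε hε
    obtain ⟨x', hx', hyx'⟩ := h t₀ (ε / 2) (half_pos hε)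
    obtain ⟨x, hx, hx'x⟩ := hx' (j t₀) (ε / 2) (half_pos hε)
    refine ⟨x, hx, ?_⟩
    filter_upwards [hyx', (hj.tendsto t₀).eventually hx'x] with t h₁ h₂
    linarith [norm_sub_le_norm_sub_add_norm_sub (y t) (x' (j t)) (x (j t))]
  · intro h t₀ ε hε
    obtain ⟨x, hx, hyx⟩ := h t₀ ε hε
    exact ⟨_, restrict_mem W hx, hyx⟩

theorem Iso.symm_mem {U : ContinuousField Ω A} {B : Type v} [NonUnitalCStarAlgebra B]
    (e : Iso U (const Ω B)) {y : Ω → B} (hy : Continuous y) :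
    (fun t => (e.φ t).symm (y t)) ∈ U.Θ := by
  rw [e.mem_iff]
  simp only [StarAlgEquiv.apply_symm_apply]
  exact hy

theorem isContinuousAlong_iff_continuous {U : ContinuousField Ω A} {V : Set Ω} {B : Type v}
    [NonUnitalCStarAlgebra B] (e : Iso (U.restrict V) (const V B)) {j : T → V} (hj : Continuous j)
    {y : ∀ t, A (j t)} :
    U.IsContinuousAlong (fun t => (j t : Ω)) y ↔ Continuous fun t => e.φ (j t) (y t) := by
  constructor
  · intro h
    refine (const T B).mem_of_locally_approx _ fun t₀ ε hε => ?_
    obtain ⟨x, hx, hyx⟩ := h t₀ ε hε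
    have hxV : Continuous fun s : V => e.φ s (x s) := (e.mem_iff _).1 (restrict_mem V hx)
    refine ⟨fun t => e.φ (j t) (x (j t)), hxV.comp hj, ?_⟩
    filter_upwards [hyx] with t ht
    rwa [← map_sub, e.norm_φ]
  · -- approximate `y` near `t₀` by the vector field that is constant in the trivialisation
    intro h t₀ ε hε
    set b := e.φ (j t₀) (y t₀)
    obtain ⟨x, hx, hbx⟩ :=
      e.symm_mem (continuous_const (y := b)) (j t₀) (ε / 2) (half_pos hε)
    refine ⟨x, hx, ?_⟩
    filter_upwards [(hj.tendsto t₀).eventually hbx,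
      Metric.tendsto_nhds.1 (h.tendsto t₀) (ε / 2) (half_pos hε)] with t h₁ h₂
    have hyb : ‖y t - (e.φ (j t)).symm b‖ < ε / 2 := by
      rwa [← e.norm_φ, map_sub, StarAlgEquiv.apply_symm_apply, ← dist_eq_norm]
    linarith [norm_sub_le_norm_sub_add_norm_sub (y t) ((e.φ (j t)).symm b) (x (j t))]

theorem IsTrivial.restrict_restrict {U : ContinuousField Ω A} {V : Set Ω}
    (h : (U.restrict V).IsTrivial) {W : Set Ω} {S : Set W} (hS : ∀ t ∈ S, (t : Ω) ∈ V) :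
    ((U.restrict W).restrict S).IsTrivial := by
  obtain ⟨B, _, ⟨e⟩⟩ := h
  let j : S → V := fun t => ⟨t, hS t t.2⟩
  refine ⟨B, inferInstance, ⟨⟨fun t => e.φ (j t), fun y => ?_⟩⟩⟩
  rw [mem_restrict, isContinuousAlong_restrict_iff continuous_subtype_val]
  exact isContinuousAlong_iff_continuous e (j := j) (by fun_prop)

theorem IsTrivial.restrict_image {U : ContinuousField Ω A} {W : Set Ω} {S : Set W}
    (h : ((U.restrict W).restrict S).IsTrivial) :
    (U.restrict (Subtype.val '' S : Set Ω)).IsTrivial := by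
  obtain ⟨B, _, ⟨e⟩⟩ := h
  have hW : ∀ t : (Subtype.val '' S : Set Ω), (t : Ω) ∈ W := by
    rintro ⟨_, s, _, rfl⟩; exact s.2
  have hS : ∀ t : (Subtype.val '' S : Set Ω), (⟨t, hW t⟩ : W) ∈ S := by
    rintro ⟨_, s, hs, rfl⟩; exact hs
  let j : (Subtype.val '' S : Set Ω) → S := fun t => ⟨⟨t, hW t⟩, hS t⟩
  refine ⟨B, inferInstance, ⟨⟨fun t => e.φ (j t), fun y => ?_⟩⟩⟩
  exact (isContinuousAlong_restrict_iff (j := fun t => (j t : W)) (by fun_prop)).symm.trans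
    (isContinuousAlong_iff_continuous e (j := j) (by fun_prop))

end Along

section Extension

variable [T2Space Ω]

theorem exists_evalHom_eq_of_isCompact {U : ContinuousField Ω A} {V K : Set Ω} (hV : IsOpen V)
    (hK : IsCompact K) (hKV : K ⊆ V) {y : ∀ t : V, A t} (hy : y ∈ (U.restrict V).Θ)
    (hyK : ∀ t : V, (t : Ω) ∉ K → y t = 0) :
    ∃ x : U.sectionAlgebra, (∀ t : V, U.evalHom t x = y t) ∧ ∀ t ∉ K, U.evalHom t x = 0 := by
  classical
  let x : ∀ t, A t := fun t => if h : t ∈ V then y ⟨t, h⟩ else 0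
  have hxV (t : V) : x t = y t := dif_pos t.2
  have hxK (t) (ht : t ∉ K) : x t = 0 := by
    by_cases h : t ∈ V
    · exact (hxV ⟨t, h⟩).trans (hyK _ ht)
    · exact dif_neg h
  have hx : x ∈ U.Θ := by
    refine U.mem_of_locally_approx x fun t ε hε => ?_
    by_cases ht : t ∈ V
    · obtain ⟨x', hx', hyx'⟩ := hy ⟨t, ht⟩ ε hε
      refine ⟨x', hx', ?_⟩
      rw [nhds_subtype_eq_comap, eventually_comap] at hyx'
      filter_upwards [hyx', hV.mem_nhds ht] with s hs hsV
      exact (hxV ⟨s, hsV⟩).symm ▸ hs ⟨s, hsV⟩ rfl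
    · refine ⟨0, zero_mem _, ?_⟩
      filter_upwards [hK.isClosed.isOpen_compl.mem_nhds fun h => ht (hKV h)] with s hs
      simpa only [hxK s hs, Pi.zero_apply, sub_zero, norm_zero] using hε.le
  have hx0 : Tendsto (fun t => ‖x t‖) (cocompact Ω) (𝓝 0) := by
    refine tendsto_const_nhds.congr' ?_
    filter_upwards [hK.compl_mem_cocompact] with t ht
    rw [hxK t ht, norm_zero]
  obtain ⟨z, hz, hzx⟩ := U.exists_mem_sectionAlgebra x hx hx0
  exact ⟨⟨z, hz⟩, fun t => (hzx t).trans (hxV t), fun t ht => (hzx t).trans (hxK t ht)⟩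

theorem exists_evalHom_eq_symm_smul {U : ContinuousField Ω A} {V : Set Ω} (hV : IsOpen V)
    {B : Type v} [NonUnitalCStarAlgebra B] (e : Iso (U.restrict V) (const V B)) {g : C(Ω, ℝ)}
    (hg : HasCompactSupport g) (hgV : tsupport g ⊆ V) (b : B) :
    ∃ x : U.sectionAlgebra, (∀ t : V, U.evalHom t x = (e.φ t).symm ((g t : ℂ) • b)) ∧
      ∀ t ∉ tsupport g, U.evalHom t x = 0 :=
  exists_evalHom_eq_of_isCompact hV hg hgV (e.symm_mem (by fun_prop)) fun t ht => by
    rw [image_eq_zero_of_notMem_tsupport ht, Complex.ofReal_zero, zero_smul, map_zero]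

end Extension

end ContinuousField

/-! ### Splitting the diagonal over a trivialising set -/

section Modules

variable {B R : Type*} [NonUnitalNormedRing B] [NormedSpace ℂ B] [NonUnitalNormedRing R]
  [NormedSpace ℂ R] [IsScalarTower ℂ R R] [SMulCommClass ℂ R R]

/-- The action of `B` by left multiplication, through a homomorphism `L : B → R`, on a subspace of a
Banach algebra `R` that is stable under it. -/
noncomputable def LeftBanachModule.ofMulLeft (L : B →L[ℂ] R) (hL : ∀ a b, L (a * b) = L a * L b)
    (Y : Submodule ℂ R) (hY : ∀ a, ∀ y ∈ Y, L a * y ∈ Y) : LeftBanachModule B Y where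
  act := LinearMap.mkContinuous₂
    (LinearMap.mk₂ ℂ (fun a y => (⟨L a * y, hY a y y.2⟩ : Y))
      (fun a b y => Subtype.ext (by simp only [map_add, add_mul, Submodule.coe_add]))
      (fun c a y => Subtype.ext (by simp only [map_smul, smul_mul_assoc, Submodule.coe_smul]))
      (fun a y z => Subtype.ext (mul_add (L a) (y : R) z))
      (fun c a y => Subtype.ext (mul_smul_comm c (L a) (y : R))))
    ‖L‖ fun a y => (norm_mul_le (L a) (y : R)).trans <|
      mul_le_mul_of_nonneg_right (L.le_opNorm a) (norm_nonneg _)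
  act_mul a b y := Subtype.ext <| by
    change L (a * b) * (y : R) = L a * (L b * y)
    rw [hL, mul_assoc]

end Modules

open scoped BoundedContinuousFunction

section BoundedFunctions

variable {V E : Type*} [TopologicalSpace V] [NormedAddCommGroup E]

theorem isClosed_setOf_tendsto_zero (l : Filter V) :
    IsClosed {f : V →ᵇ E | Tendsto f l (𝓝 0)} := by
  refine isClosed_of_closure_subset fun f hf => Metric.tendsto_nhds.2 fun ε hε => ?_
  obtain ⟨g, hg, hfg⟩ := Metric.mem_closure_iff.1 hf (ε / 2) (half_pos hε)
  filter_upwards [Metric.tendsto_nhds.1 hg (ε / 2) (half_pos hε)] with t ht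
  linarith [dist_triangle (f t) (g t) 0, (f.dist_coe_le_dist (g := g) t).trans_lt hfg]

theorem exists_locallyFinite_cover_of_tendsto_zero {k : V → (V →ᵇ E)} (hk : Continuous k) {δ : ℝ}
    (hδ : 0 < δ) (hkδ : ∀ s, δ ≤ ‖k s s‖) {l : Filter V} (hl : ∀ s, Tendsto (k s) l (𝓝 0)) :
    ∃ D : V → Set V, (∀ s, IsOpen (D s)) ∧ (⋃ s, D s) = Set.univ ∧ LocallyFinite D ∧
      ∀ s, (D s)ᶜ ∈ l := by
  -- pull back a locally finite refinement of a cover of the metric space `range k` by small balls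
  obtain ⟨v, hvo, hvu, hvf, hvs⟩ := precise_refinement
    (fun s : V => Metric.ball (Set.rangeFactorization k s) (δ / 2)) (fun s => Metric.isOpen_ball)
    (Set.eq_univ_of_forall <| by
      rintro ⟨_, s, rfl⟩
      exact Set.mem_iUnion.2 ⟨s, Metric.mem_ball_self (half_pos hδ)⟩)
  have hk' : Continuous (Set.rangeFactorization k) := hk.subtype_mk _
  refine ⟨fun s => Set.rangeFactorization k ⁻¹' v s, fun s => (hvo s).preimage hk', ?_,
    hvf.preimage_continuous hk', fun s => ?_⟩
  · rw [← Set.preimage_iUnion, hvu, Set.preimage_univ]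
  · filter_upwards [Metric.tendsto_nhds.1 (hl s) (δ / 2) (half_pos hδ)] with t ht hts
    have hdist : dist (k t) (k s) < δ / 2 := hvs s hts
    have := (k t).dist_coe_le_dist (g := k s) t
    rw [dist_eq_norm] at this
    rw [dist_zero_right] at ht
    linarith [hkδ t, norm_le_norm_add_norm_sub' (k t t) (k s t)]

/-- Constant functions, as a bounded linear map. -/
noncomputable def constBoundedContinuous (V E : Type*) [TopologicalSpace V] [NormedAddCommGroup E]
    [NormedSpace ℂ E] : E →L[ℂ] (V →ᵇ E) :=
  LinearMap.mkContinuous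
    { toFun := BoundedContinuousFunction.const V
      map_add' := fun _ _ => rfl
      map_smul' := fun _ _ => rfl } 1
    fun b => (BoundedContinuousFunction.norm_const_le b).trans_eq (one_mul _).symm

end BoundedFunctions

namespace ContinuousField

variable {Ω : Type u} [TopologicalSpace Ω] {A : Ω → Type v} [∀ t, NonUnitalCStarAlgebra (A t)]
  {U : ContinuousField Ω A} {V : Set Ω} {B : Type v} [NonUnitalCStarAlgebra B]

section Kernel

variable (e : Iso (U.restrict V) (const V B))

/-- The sections of a field, read in a trivialisation over `V`. -/
noncomputable def readIn : U.sectionAlgebra →L[ℂ] (V →ᵇ B) :=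
  LinearMap.mkContinuous
    { toFun := fun x => BoundedContinuousFunction.ofNormedAddCommGroup
        (fun t : V => e.φ t (U.evalHom t x)) ((e.mem_iff _).1 (restrict_mem V (evalHom_mem x))) ‖x‖
        fun t => (e.norm_φ t _).trans_le (norm_evalHom_le _ x)
      map_add' := fun x y => by
        ext t
        exact map_add (e.φ t) (U.evalHom t x) (U.evalHom t y)
      map_smul' := fun c x => by
        ext t
        exact map_smul (e.φ t) c (U.evalHom t x) } 1
    fun x => by
      rw [one_mul]
      exact BoundedContinuousFunction.norm_ofNormedAddCommGroup_le _ (norm_nonneg x)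
        fun t => (e.norm_φ t _).trans_le (norm_evalHom_le _ x)

theorem readIn_apply (x : U.sectionAlgebra) (t : V) : readIn e x t = e.φ t (U.evalHom t x) :=
  rfl

theorem readIn_mul (x y : U.sectionAlgebra) : readIn e (x * y) = readIn e x * readIn e y := by
  ext t
  exact map_mul (e.φ t) (U.evalHom t x) (U.evalHom t y)

theorem tendsto_readIn (x : U.sectionAlgebra) :
    Tendsto (readIn e x) (comap ((↑) : V → Ω) (cocompact Ω)) (𝓝 0) := by
  refine tendsto_zero_iff_norm_tendsto_zero.2 ?_
  simp only [readIn_apply, e.norm_φ]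
  exact (tendsto_norm_evalHom x).comp tendsto_comap

/-- The module of pairs `(F, x)` of a bounded continuous function `F` of two variables in `V` and a
section `x` such that `F s s = x s` and `F s` vanishes at infinity (of `Ω`) for each `s`. It maps
onto the section algebra by `(F, x) ↦ x`. -/
def kernelModule : Submodule ℂ ((V →ᵇ (V →ᵇ B)) × U.sectionAlgebra) where
  carrier := {p | (∀ s, p.1 s s = readIn e p.2 s) ∧
    ∀ s, Tendsto (p.1 s) (comap ((↑) : V → Ω) (cocompact Ω)) (𝓝 0)}
  add_mem' := by
    rintro p q ⟨hp, hp'⟩ ⟨hq, hq'⟩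
    exact ⟨fun s => by simp [hp, hq], fun s => by simpa [Pi.add_def] using (hp' s).add (hq' s)⟩
  zero_mem' := ⟨fun s => by simp, fun _ => tendsto_const_nhds⟩
  smul_mem' := by
    rintro c p ⟨hp, hp'⟩
    exact ⟨fun s => by simp [hp], fun s => by simpa using (hp' s).const_smul c⟩

theorem isClosed_kernelModule :
    IsClosed (kernelModule e : Set ((V →ᵇ (V →ᵇ B)) × U.sectionAlgebra)) := by
  have heval (s : V) : Continuous fun p : (V →ᵇ (V →ᵇ B)) × U.sectionAlgebra => p.1 s :=
    (BoundedContinuousFunction.lipschitz_eval_const s).continuous.comp continuous_fst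
  have hread (s : V) : Continuous fun p : (V →ᵇ (V →ᵇ B)) × U.sectionAlgebra => readIn e p.2 s :=
    (BoundedContinuousFunction.lipschitz_eval_const s).continuous.comp
      ((readIn e).continuous.comp continuous_snd)
  have hdiag (s : V) := isClosed_eq
    ((BoundedContinuousFunction.lipschitz_eval_const s).continuous.comp (heval s)) (hread s)
  have hvanish (s : V) := (isClosed_setOf_tendsto_zero (E := B)
    (comap ((↑) : V → Ω) (cocompact Ω))).preimage (heval s)
  convert (isClosed_iInter hdiag).inter (isClosed_iInter hvanish)
  ext p
  simp [kernelModule]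

instance completeSpace_kernelModule : CompleteSpace (kernelModule e) :=
  (isClosed_kernelModule e).completeSpace_coe

/-- A section, as a function of two variables that depends on the first one only. -/
noncomputable def leftFactor : U.sectionAlgebra →L[ℂ] (V →ᵇ (V →ᵇ B)) × U.sectionAlgebra :=
  (((constBoundedContinuous V B).compLeftContinuousBounded V).comp (readIn e)).prod
    (ContinuousLinearMap.id ℂ _)

theorem leftFactor_mul (a b : U.sectionAlgebra) :
    leftFactor e (a * b) = leftFactor e a * leftFactor e b := by
  refine Prod.ext ?_ rfl
  ext s _
  exact DFunLike.congr_fun (readIn_mul e a b) s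

theorem leftFactor_mul_mem (a : U.sectionAlgebra) {p : (V →ᵇ (V →ᵇ B)) × U.sectionAlgebra}
    (hp : p ∈ kernelModule e) : leftFactor e a * p ∈ kernelModule e := by
  refine ⟨fun s => ?_, fun s => ?_⟩
  · change readIn e a s * p.1 s s = readIn e (a * p.2) s
    rw [hp.1 s, readIn_mul, BoundedContinuousFunction.mul_apply]
  · simpa using! (hp.2 s).const_mul (readIn e a s)

theorem exists_kernel (hP : IsLeftProjective.{max u v, w} U.sectionAlgebra) :
    ∃ F : U.sectionAlgebra → (V →ᵇ (V →ᵇ B)),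
      (∀ a b s t, F (a * b) s t = readIn e a s * F b s t) ∧ (∀ a s, F a s s = readIn e a s) ∧
      ∀ a s, Tendsto (F a s) (comap ((↑) : V → Ω) (cocompact Ω)) (𝓝 0) := by
  let secondFactor : U.sectionAlgebra →L[ℂ] kernelModule e :=
    (((constBoundedContinuous V (V →ᵇ B)).comp (readIn e)).prod
      (ContinuousLinearMap.id ℂ _)).codRestrict (kernelModule e)
      fun a => ⟨fun _ => rfl, fun _ => tendsto_readIn e a⟩
  obtain ⟨ψ, hψmul, hψ⟩ := hP.exists_splitting
    (.ofMulLeft (leftFactor e) (leftFactor_mul e) (kernelModule e)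
      fun a _ => leftFactor_mul_mem e a)
    ((ContinuousLinearMap.snd ℂ _ _).comp (kernelModule e).subtypeL) (fun _ _ => rfl)
    secondFactor (fun _ => rfl)
  refine ⟨fun a => (ψ a).1.1, fun a b s t => ?_, fun a s => ?_, fun a s => (ψ a).2.2 s⟩
  · exact congrArg (fun p : kernelModule e => p.1.1 s t) (hψmul a b)
  · exact ((ψ a).2.1 s).trans (congrArg (fun x => readIn e x s) (hψ a))

end Kernel

variable [T2Space Ω] [LocallyCompactSpace Ω]

/-- The section with the constant value `b` near `s` gives the value at `s`; multiplying by `c` on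
the left makes the result independent of the cut-off. -/
theorem exists_continuous_kernel (hV : IsOpen V) (e : Iso (U.restrict V) (const V B))
    (hP : IsLeftProjective.{max u v, w} U.sectionAlgebra) (c b : B) :
    ∃ k : V → (V →ᵇ B), Continuous k ∧ (∀ s, k s s = c * b) ∧
      ∀ s, Tendsto (k s) (comap ((↑) : V → Ω) (cocompact Ω)) (𝓝 0) := by
  obtain ⟨F, hFmul, hFdiag, hF0⟩ := exists_kernel e hP
  choose g hg1 hgc hgV using fun s : V => exists_continuousMap_eventuallyEq_one hV s.2
  choose x hx hx0 using fun s b => exists_evalHom_eq_symm_smul hV e (hgc s) (hgV s) b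
  have readIn_x (s b) (t : V) : readIn e (x s b) t = (g s t : ℂ) • b := by
    rw [readIn_apply, hx, StarAlgEquiv.apply_symm_apply]
  have x_mul_x (s s') : x s c * x s' b = x s' c * x s b := by
    refine ext_evalHom fun t => ?_
    by_cases ht : t ∈ V
    · lift t to V using ht
      rw [map_mul, map_mul, hx, hx, hx, hx, ← map_mul, ← map_mul, smul_mul_smul_comm,
        smul_mul_smul_comm, mul_comm (g s t : ℂ)]
    · simp only [map_mul, hx0 _ _ t fun h => ht (hgV _ h), mul_zero]
  have indep (s s' t : V) (h : g s t = 1) (h' : g s' t = 1) :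
      c • F (x s b) t = c • F (x s' b) t := by
    ext r
    have := congrArg (fun z => F z t r) (x_mul_x s' s)
    simpa only [hFmul, readIn_x, h, h', Complex.ofReal_one, one_smul] using! this
  refine ⟨fun s => c • F (x s b) s, ?_, fun s => ?_, fun s => ?_⟩
  · refine continuous_iff_continuousAt.2 fun s => ?_
    refine ((F (x s b)).continuous.const_smul c).continuousAt.congr ?_
    filter_upwards [(continuous_subtype_val.tendsto s).eventually (hg1 s)] with t ht
    exact indep s t t ht (hg1 t).self_of_nhds
  · simp [hFdiag, readIn_x, (hg1 s).self_of_nhds]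
  · simpa using (hF0 (x s b) s).const_mul c

theorem IsTrivial.exists_locallyFinite_cover [∀ t, Nontrivial (A t)]
    (hT : (U.restrict V).IsTrivial) (hV : IsOpen V)
    (hP : IsLeftProjective.{max u v, w} U.sectionAlgebra) :
    ∃ D : V → Set V, (∀ s, IsOpen (D s)) ∧ (⋃ s, D s) = Set.univ ∧ LocallyFinite D ∧
      ∀ s, ∃ K, IsCompact K ∧ Subtype.val '' D s ⊆ K := by
  obtain ⟨B, _, ⟨e⟩⟩ := hT
  rcases isEmpty_or_nonempty V with _ | ⟨⟨t⟩⟩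
  · exact ⟨fun _ => Set.univ, isEmptyElim, Subsingleton.elim _ _, isEmptyElim, isEmptyElim⟩
  obtain ⟨a, ha⟩ := exists_ne (0 : A t)
  set b := e.φ t a
  have hb : 0 < ‖star b * b‖ := by
    rw [CStarRing.norm_star_mul_self, e.norm_φ]
    positivity
  obtain ⟨k, hk, hkb, hk0⟩ := exists_continuous_kernel hV e hP (star b) b
  obtain ⟨D, hDo, hDu, hDf, hD⟩ :=
    exists_locallyFinite_cover_of_tendsto_zero hk hb (fun s => (congrArg norm (hkb s)).ge) hk0
  refine ⟨D, hDo, hDu, hDf, fun s => ?_⟩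
  obtain ⟨T, hT, hTD⟩ := mem_comap.1 (hD s)
  obtain ⟨K, hK, hKT⟩ := mem_cocompact.1 hT
  refine ⟨K, hK, Set.image_subset_iff.2 fun t ht => ?_⟩
  by_contra htK
  exact hTD (hKT htK) ht

end ContinuousField

/-! ### Paracompactness of the base -/

section Covers

variable {Ω : Type u} [TopologicalSpace Ω]

theorem locallyFinite_inter_image_val {V S : Set Ω} (hS : IsOpen S) (hVS : closure V ⊆ S)
    {ι : Type*} {D : ι → Set S} (hD : LocallyFinite D) :
    LocallyFinite fun i => V ∩ Subtype.val '' D i := by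
  intro t
  by_cases ht : t ∈ S
  · obtain ⟨N, hN, hfin⟩ := hD ⟨t, ht⟩
    refine ⟨_, hS.isOpenMap_subtype_val.image_mem_nhds hN, hfin.subset ?_⟩
    rintro i ⟨_, ⟨-, s, hs, rfl⟩, s', hs', h⟩
    exact ⟨s, hs, Subtype.ext h ▸ hs'⟩
  · refine ⟨(closure V)ᶜ, isClosed_closure.isOpen_compl.mem_nhds fun h => ht (hVS h), ?_⟩
    refine Set.finite_empty.subset ?_
    rintro i ⟨s, ⟨hs, -⟩, hs'⟩
    exact hs' (subset_closure hs)

theorem IsOpenPartition.paracompactSpace_of_countable_locallyFinite [T2Space Ω]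
    [LocallyCompactSpace Ω] {M : Type u} {W : M → Set Ω} (hW : IsOpenPartition W) {J : M → Type u}
    [∀ μ, Countable (J μ)] {ι : ∀ μ, J μ → Type u} {C : ∀ μ j, ι μ j → Set Ω}
    (ho : ∀ μ j i, IsOpen (C μ j i)) (hf : ∀ μ j, LocallyFinite (C μ j))
    (hc : ∀ μ j i, IsCompact (closure (C μ j i))) (hu : ∀ μ, (⋃ j, ⋃ i, C μ j i) = W μ) :
    ParacompactSpace Ω := by
  let D : (Σ μ, Σ j, ι μ j) → Set Ω := fun p => C p.1 p.2.1 p.2.2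
  have hDW (p) : D p ⊆ W p.1 := by
    rw [← hu p.1]
    exact Set.subset_iUnion₂_of_subset p.2.1 p.2.2 subset_rfl
  have hDu : (⋃ p, D p) = Set.univ := by
    simp only [Set.iUnion_sigma, D, hu, hW.iUnion_eq]
  refine (isSigmaCompactPartition_chainComponent (C := D) (fun p => ho _ _ _) hDu
    (fun p => hc _ _ _) fun ⟨μ, j, i⟩ => ?_).paracompactSpace
  have hcountable : (⋃ j', (fun i' => (⟨μ, j', i'⟩ : Σ μ, Σ j, ι μ j)) ''
      {i' | (C μ j' i' ∩ closure (C μ j i)).Nonempty}).Countable :=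
    Set.countable_iUnion fun j' =>
      (((hf μ j').finite_nonempty_inter_compact (hc μ j i)).image _).countable
  refine hcountable.mono ?_
  rintro ⟨ν, j', i'⟩ ⟨t, ht, ht'⟩
  obtain rfl := hW.eq_of_mem (hDW _ ht) (hDW _ ht')
  exact Set.mem_iUnion.2 ⟨j', i', ⟨t, ht', subset_closure ht⟩, rfl⟩

theorem exists_countable_iUnion_eq_univ [SigmaCompactSpace Ω] {N : Ω → Set Ω}
    (hN : ∀ t, N t ∈ 𝓝 t) :
    ∃ (J : Type) (_ : Countable J) (f : J → Ω), (⋃ j, N (f j)) = Set.univ := by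
  obtain ⟨s, hs, hsu⟩ := countable_cover_nhds_of_sigmaCompact hN
  have := hs.to_subtype
  obtain ⟨g, hg⟩ := exists_injective_nat s
  let e := (Equiv.ofInjective g hg).symm
  refine ⟨Set.range g, inferInstance, fun j => e j, ?_⟩
  rw [← hsu, Set.biUnion_eq_iUnion]
  exact e.surjective.iUnion_comp fun t : s => N t

end Covers

namespace ContinuousField

variable {Ω : Type u} [TopologicalSpace Ω] {A : Ω → Type v} [∀ t, NonUnitalCStarAlgebra (A t)]

theorem IsSigmaLocallyTrivial.exists_cover {U : ContinuousField Ω A} {W : Set Ω} (ho : IsOpen W)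
    (hc : IsClosed W) (h : (U.restrict W).IsSigmaLocallyTrivial) :
    ∃ (J : Type) (_ : Countable J) (V S : J → Set Ω), (∀ j, IsOpen (V j)) ∧ (∀ j, IsOpen (S j)) ∧
      (⋃ j, V j) = W ∧ (∀ j, closure (V j) ⊆ S j) ∧ ∀ j, (U.restrict (S j)).IsTrivial := by
  obtain ⟨M, S, hSo, -, hSt, J, hJ, V, hVo, hVu, hVS⟩ := h
  choose μ hμ using hVS
  refine ⟨J, hJ, fun j => Subtype.val '' V j, fun j => Subtype.val '' S (μ j), fun j => ?_,
    fun j => ?_, ?_, fun j => ?_, fun j => (hSt (μ j)).restrict_image⟩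
  · exact ho.isOpenMap_subtype_val _ (hVo j)
  · exact ho.isOpenMap_subtype_val _ (hSo (μ j))
  · rw [← Set.image_iUnion, hVu, Set.image_univ, Subtype.range_coe]
  · rw [hc.isClosedEmbedding_subtypeVal.closure_image_eq]
    exact Set.image_mono (hμ j)

variable [T2Space Ω] [LocallyCompactSpace Ω] {U : ContinuousField Ω A}

theorem IsDisjointUnionOfSigmaLocallyTrivial.paracompactSpace [∀ t, Nontrivial (A t)]
    (hD : U.IsDisjointUnionOfSigmaLocallyTrivial)
    (hP : IsLeftProjective.{max u v, w} U.sectionAlgebra) : ParacompactSpace Ω := by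
  obtain ⟨M, W, hWo, hWd, hWu, hWs⟩ := hD
  have hW : IsOpenPartition W := ⟨hWo, hWd, hWu⟩
  choose J hJ V S hVo hSo hVW hVS hSt using fun μ =>
    IsSigmaLocallyTrivial.exists_cover (hWo μ) (hW.isClosed μ) (hWs μ).1
  choose D hDo hDu hDf K hK hDK using fun μ j => (hSt μ j).exists_locallyFinite_cover (hSo μ j) hP
  refine hW.paracompactSpace_of_countable_locallyFinite (J := fun μ => ULift.{u} (J μ))
    (ι := fun μ (j : ULift (J μ)) => S μ j.down)
    (C := fun μ (j : ULift (J μ)) s => V μ j.down ∩ Subtype.val '' D μ j.down s)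
    (fun μ j s => (hVo _ _).inter ((hSo _ _).isOpenMap_subtype_val _ (hDo _ _ _)))
    (fun μ j => locallyFinite_inter_image_val (hSo _ _) (hVS _ _) (hDf _ _))
    (fun μ j s => (hK μ j.down s).closure_of_subset (Set.inter_subset_right.trans (hDK _ _ _)))
    fun μ => ?_
  have hVD (j : J μ) : (⋃ s, V μ j ∩ Subtype.val '' D μ j s) = V μ j := by
    rw [← Set.inter_iUnion, ← Set.image_iUnion, hDu, Set.image_univ, Subtype.range_coe]
    exact Set.inter_eq_left.2 (subset_closure.trans (hVS μ j))
  rw [← hVW μ]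
  exact (Set.iUnion_congr fun j : ULift (J μ) => hVD j.down).trans
    (Equiv.ulift.surjective.iUnion_comp (V μ))

theorem IsLocallyTrivial.isDisjointUnionOfSigmaLocallyTrivial (hU : U.IsLocallyTrivial)
    (hpos : U.HasStrictlyPositiveElements) {M : Type u} {W : M → Set Ω}
    (hW : IsSigmaCompactPartition W) : U.IsDisjointUnionOfSigmaLocallyTrivial := by
  refine ⟨M, W, hW.isOpen, hW.disjoint, hW.iUnion_eq, fun μ => ⟨?_, fun t => hpos t⟩⟩
  choose V hVo hVt hV using hU
  have := isSigmaCompact_iff_sigmaCompactSpace.1 (hW.isSigmaCompact μ)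
  have := (hW.isOpen μ).locallyCompactSpace
  let S (t : W μ) : Set (W μ) := Subtype.val ⁻¹' V t
  have hSo (t) : IsOpen (S t) := (hVo t).preimage continuous_subtype_val
  have hSt (t) : t ∈ S t := hVt t
  choose K hK htK hKS using fun t => exists_compact_subset (hSo t) (hSt t)
  obtain ⟨J, hJ, f, hf⟩ :=
    exists_countable_iUnion_eq_univ fun t => isOpen_interior.mem_nhds (htK t)
  refine ⟨W μ, S, hSo, Set.iUnion_eq_univ_iff.2 fun t => ⟨t, hSt t⟩,
    fun t => (hV t).restrict_restrict fun _ h => h, J, hJ, fun j => interior (K (f j)),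
    fun j => isOpen_interior, hf, fun j => ⟨f j, ?_⟩⟩
  exact (closure_minimal interior_subset (hK _).isClosed).trans (hKS _)

end ContinuousField

/-! ### Strictly positive elements -/

theorem exists_re_apply_neg_of_notMem_closure {E : Type*} [NormedAddCommGroup E] [NormedSpace ℂ E]
    {K : PointedCone ℝ E} {x : E} (hx : x ∉ closure (K : Set E)) :
    ∃ f : E →L[ℂ] ℂ, (∀ y ∈ K, 0 ≤ (f y).re) ∧ (f x).re < 0 := by
  obtain ⟨f, hfK, hfx⟩ := ProperCone.hyperplane_separation_point (Submodule.closure K) hx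
  refine ⟨f.extendRCLike, fun y hy => ?_, ?_⟩
  · simpa [StrongDual.extendRCLike_apply] using hfK y (subset_closure hy)
  · simpa [StrongDual.extendRCLike_apply] using hfx

section PositiveCone

variable {B : Type v} [NonUnitalCStarAlgebra B] [PartialOrder B] [StarOrderedRing B]

/-- The cone of the elements `y` with `-(t • h) ≤ ℜ y` for some `t ≥ 0`. A functional whose
real part is nonnegative on it is positive and has nonpositive real part at `h`. -/
noncomputable def boundedBelowCone (h : B) : PointedCone ℝ B where
  carrier := {y | ∃ t : ℝ, 0 ≤ t ∧ 0 ≤ (realPart y : B) + t • h}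
  zero_mem' := ⟨0, le_rfl, by simp⟩
  add_mem' := by
    rintro x y ⟨s, hs, hx⟩ ⟨t, ht, hy⟩
    refine ⟨s + t, add_nonneg hs ht, (add_nonneg hx hy).trans_eq ?_⟩
    rw [map_add, AddSubgroup.coe_add, add_smul]
    abel
  smul_mem' := by
    rintro ⟨r, hr⟩ y ⟨t, ht, hy⟩
    refine ⟨r * t, mul_nonneg hr ht, ?_⟩
    simpa [mul_smul, NNReal.smul_def] using smul_nonneg hr hy

end PositiveCone

namespace IsStrictlyPositiveElement

variable {B : Type v} [NonUnitalCStarAlgebra B] {h : B}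

theorem map_equiv {B' : Type v} [NonUnitalCStarAlgebra B'] (hh : IsStrictlyPositiveElement h)
    (e : B ≃⋆ₐ[ℂ] B') : IsStrictlyPositiveElement (e h) := by
  obtain ⟨⟨b, rfl⟩, hstr⟩ := hh
  refine ⟨⟨e b, by rw [map_mul, map_star]⟩, fun f hf hf0 => ?_⟩
  let e' : B →L[ℂ] B' :=
    ⟨(e : B →ₗ[ℂ] B'), (NonUnitalStarAlgHom.isometry e e.injective).continuous⟩
  have he' (x : B) : e' x = e x := rfl
  refine hstr (f.comp e') (fun x => ?_) fun h0 => hf0 ?_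
  · simpa only [ContinuousLinearMap.comp_apply, he', map_mul, map_star] using hf (e x)
  · ext y
    simpa [he'] using DFunLike.congr_fun h0 (e.symm y)

variable [PartialOrder B] [StarOrderedRing B]

theorem nonneg (hh : IsStrictlyPositiveElement h) : 0 ≤ h := by
  obtain ⟨b, rfl⟩ := hh.1
  exact star_mul_self_nonneg b

theorem dense_boundedBelowCone (hh : IsStrictlyPositiveElement h) :
    Dense (boundedBelowCone h : Set B) := by
  intro x
  by_contra hx
  obtain ⟨f, hf, hfx⟩ := exists_re_apply_neg_of_notMem_closure hx
  have hf0 : f ≠ 0 := by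
    rintro rfl
    simp at hfx
  refine (hh.2 f (fun b => ⟨hf _ ⟨0, le_rfl, ?_⟩, ?_⟩) hf0).not_ge ?_
  · simp [(IsSelfAdjoint.star_mul_self b).coe_realPart]
  · have him (z : ℂ) (hz : z.re = 0) : 0 ≤ (z * f (star b * b)).re := by
      rw [← smul_eq_mul, ← map_smul]
      refine hf _ ⟨0, le_rfl, ?_⟩
      simp [realPart_smul, hz, (IsSelfAdjoint.star_mul_self b).imaginaryPart]
    have h1 := him Complex.I rfl
    have h2 := him (-Complex.I) (by simp)
    simp only [Complex.I_mul_re, neg_mul, Complex.neg_re] at h1 h2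
    linarith
  · have : -h ∈ boundedBelowCone h :=
      ⟨1, zero_le_one, by simp [(IsSelfAdjoint.of_nonneg hh.nonneg).coe_realPart]⟩
    simpa using hf _ this

theorem exists_le_smul_add (hh : IsStrictlyPositiveElement h) {p : B} (hp : IsSelfAdjoint p)
    {δ : ℝ} (hδ : 0 < δ) : ∃ t : ℝ, 0 ≤ t ∧ ∃ e : B, ‖e‖ < δ ∧ p ≤ t • h + e := by
  obtain ⟨y, ⟨t, ht, hy⟩, hyp⟩ := Metric.mem_closure_iff.1 (hh.dense_boundedBelowCone (-p)) δ hδ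
  refine ⟨t, ht, realPart (y + p), (realPart.norm_le (y + p)).trans_lt ?_, ?_⟩
  · rwa [dist_eq_norm, ← neg_add', norm_neg, add_comm] at hyp
  · rw [map_add, AddSubgroup.coe_add, hp.coe_realPart, ← add_assoc, add_comm (t • h)]
    exact le_add_of_nonneg_left hy

end IsStrictlyPositiveElement

/-! ### Approximate units in the functional calculus -/

section Ramp

/-- The piecewise linear function that vanishes up to `2⁻ⁿ` and is `1` from `2¹⁻ⁿ` on. -/
noncomputable def ramp (n : ℕ) (x : ℝ) : ℝ := max 0 (min 1 (2 ^ n * x - 1))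

theorem continuous_ramp (n : ℕ) : Continuous (ramp n) := by
  unfold ramp
  fun_prop

theorem ramp_apply_zero (n : ℕ) : ramp n 0 = 0 := by simp [ramp]

theorem ramp_nonneg (n : ℕ) (x : ℝ) : 0 ≤ ramp n x := le_max_left _ _

theorem ramp_le_one (n : ℕ) (x : ℝ) : ramp n x ≤ 1 := by simp [ramp]

theorem ramp_eq_zero {n : ℕ} {x : ℝ} (h : 2 ^ n * x ≤ 1) : ramp n x = 0 :=
  max_eq_left ((min_le_right _ _).trans (by linarith))

theorem ramp_eq_one {n : ℕ} {x : ℝ} (h : 2 ≤ 2 ^ n * x) : ramp n x = 1 := by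
  rw [ramp, min_eq_left (by linarith), max_eq_right zero_le_one]

theorem ramp_eq_one_of_ne_zero {m n : ℕ} (hmn : m < n) {x : ℝ} (h : ramp m x ≠ 0) :
    ramp n x = 1 := by
  have h1 : 1 < 2 ^ m * x := not_le.1 fun hle => h (ramp_eq_zero hle)
  have hx : 0 < x := pos_of_mul_pos_right (zero_lt_one.trans h1) (by positivity)
  refine ramp_eq_one ?_
  calc (2 : ℝ) ≤ 2 ^ (m + 1) * x := by rw [pow_succ]; linarith
    _ ≤ 2 ^ n * x := by
      gcongr
      exacts [one_le_two, hmn]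

theorem ramp_le_ramp {m n : ℕ} (hmn : m ≤ n) (x : ℝ) : ramp m x ≤ ramp n x := by
  obtain rfl | hlt := hmn.eq_or_lt
  · exact le_rfl
  · by_cases h0 : ramp m x = 0
    · exact h0.trans_le (ramp_nonneg n x)
    · exact (ramp_le_one m x).trans_eq (ramp_eq_one_of_ne_zero hlt h0).symm

theorem abs_mul_one_sub_ramp_le (n : ℕ) {x : ℝ} (hx : 0 ≤ x) :
    |x * (1 - ramp n x)| ≤ 2 / 2 ^ n := by
  have h0 := ramp_nonneg n x
  have h1 := ramp_le_one n x
  rw [abs_of_nonneg (mul_nonneg hx (by linarith))]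
  obtain h | h := le_total 2 (2 ^ n * x)
  · rw [ramp_eq_one h, sub_self, mul_zero]
    positivity
  · rw [le_div_iff₀ (by positivity)]
    nlinarith [mul_nonneg (mul_nonneg hx h0) (by positivity : (0 : ℝ) ≤ 2 ^ n)]

variable {B : Type*} [NonUnitalCStarAlgebra B]

theorem norm_cfcₙ_ramp_le_one (n : ℕ) (h : B) : ‖cfcₙ (ramp n) h‖ ≤ 1 :=
  norm_cfcₙ_le fun x _ => (Real.norm_of_nonneg (ramp_nonneg n x)).trans_le (ramp_le_one n x)

theorem cfcₙ_mul_one_sub_ramp {h : B} (hsa : IsSelfAdjoint h) (n : ℕ) :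
    cfcₙ (fun x => x * (1 - ramp n x)) h = h - cfcₙ (ramp n) h * h := by
  have hr := (continuous_ramp n).continuousOn (s := quasispectrum ℝ h)
  calc cfcₙ (fun x => x * (1 - ramp n x)) h
      = cfcₙ (fun x => x - ramp n x * x) h := by
        congr 1
        funext x
        ring
    _ = h - cfcₙ (ramp n) h * h := by
        rw [cfcₙ_sub (fun x => x) (fun x => ramp n x * x) h continuousOn_id rfl
          (hr.mul continuousOn_id) (mul_zero _), cfcₙ_mul (ramp n) (fun x => x) h hr
          (ramp_apply_zero n) continuousOn_id rfl, cfcₙ_id' ℝ h]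

variable [PartialOrder B] [StarOrderedRing B]

theorem norm_sub_cfcₙ_ramp_mul_le {h : B} (hh : 0 ≤ h) (n : ℕ) :
    ‖h - cfcₙ (ramp n) h * h‖ ≤ 2 / 2 ^ n := by
  rw [← cfcₙ_mul_one_sub_ramp (.of_nonneg hh)]
  exact norm_cfcₙ_le fun x hx =>
    abs_mul_one_sub_ramp_le n (quasispectrum_nonneg_of_nonneg h hh x hx)

theorem norm_sub_mul_sq_le {a h e r : B} (hr : IsSelfAdjoint r) (hr1 : ‖r‖ ≤ 1) {t : ℝ}
    (ht : 0 ≤ t) (hle : star a * a ≤ t • h + e) :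
    ‖a - a * r‖ ^ 2 ≤ 2 * t * ‖h - r * h‖ + 4 * ‖e‖ := by
  -- compress the inequality by `1 - r` from both sides
  let T (x : B) : B := x - r * x - (x - r * x) * r
  have hT (x : B) : star (x - x * r) * (x - x * r) = T (star x * x) := by
    rw [star_sub, star_mul, hr.star_eq]
    simp only [T, sub_mul, mul_sub, mul_assoc]
  obtain ⟨z, hz⟩ := CStarAlgebra.nonneg_iff_eq_star_mul_self.1 (sub_nonneg.2 hle)
  have hTle : T (star a * a) ≤ t • T h + T e := by
    rw [← sub_nonneg, show t • T h + T e - T (star a * a) = star (z - z * r) * (z - z * r) by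
      rw [hT, ← hz]
      simp only [T, smul_sub, mul_sub, sub_mul, mul_add, add_mul, smul_mul_assoc, mul_smul_comm]
      abel]
    exact star_mul_self_nonneg _
  have hmul (x : B) : ‖x - x * r‖ ≤ 2 * ‖x‖ := by
    refine (norm_sub_le _ _).trans ?_
    linarith [(norm_mul_le x r).trans (mul_le_of_le_one_right (norm_nonneg x) hr1)]
  have hmul' (x : B) : ‖x - r * x‖ ≤ 2 * ‖x‖ := by
    refine (norm_sub_le _ _).trans ?_
    linarith [(norm_mul_le r x).trans (mul_le_of_le_one_left (norm_nonneg x) hr1)]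
  calc ‖a - a * r‖ ^ 2 = ‖T (star a * a)‖ := by rw [← hT, CStarRing.norm_star_mul_self, sq]
    _ ≤ ‖t • T h + T e‖ :=
        CStarAlgebra.norm_le_norm_of_nonneg_of_le (hT a ▸ star_mul_self_nonneg _) hTle
    _ ≤ t * ‖T h‖ + ‖T e‖ := by
        refine (norm_add_le _ _).trans_eq ?_
        rw [norm_smul, Real.norm_of_nonneg ht]
    _ ≤ t * (2 * ‖h - r * h‖) + 2 * (2 * ‖e‖) := by
        gcongr
        · exact hmul _
        · exact (hmul _).trans (by gcongr; exact hmul' e)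
    _ = 2 * t * ‖h - r * h‖ + 4 * ‖e‖ := by ring

end Ramp

theorem IsStrictlyPositiveElement.tendsto_mul_cfcₙ_ramp {B : Type v} [NonUnitalCStarAlgebra B]
    {h : B} (hh : IsStrictlyPositiveElement h) (a : B) :
    Tendsto (fun n => a * cfcₙ (ramp n) h) atTop (𝓝 a) := by
  let _ := CStarAlgebra.spectralOrder B
  have := CStarAlgebra.spectralOrderedRing B
  refine Metric.tendsto_nhds.2 fun ε hε => ?_
  obtain ⟨t, ht, e, he, hle⟩ :=
    hh.exists_le_smul_add (IsSelfAdjoint.star_mul_self a) (show 0 < ε ^ 2 / 8 by positivity)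
  have hlim : Tendsto (fun n : ℕ => 2 * t * (2 / 2 ^ n)) atTop (𝓝 0) := by
    have := (tendsto_pow_atTop_atTop_of_one_lt one_lt_two).const_div_atTop (2 : ℝ)
    simpa only [mul_zero] using this.const_mul (2 * t)
  filter_upwards [hlim.eventually_lt_const (show 0 < ε ^ 2 / 2 by positivity)] with n hn
  rw [dist_comm, dist_eq_norm]
  refine lt_of_pow_lt_pow_left₀ 2 hε.le ?_
  calc ‖a - a * cfcₙ (ramp n) h‖ ^ 2
      ≤ 2 * t * ‖h - cfcₙ (ramp n) h * h‖ + 4 * ‖e‖ :=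
        norm_sub_mul_sq_le (cfcₙ_predicate _ _) (norm_cfcₙ_ramp_le_one n h) ht hle
    _ ≤ 2 * t * (2 / 2 ^ n) + 4 * ‖e‖ := by
        gcongr
        exact norm_sub_cfcₙ_ramp_mul_le hh.nonneg n
    _ < ε ^ 2 := by linarith

section Bump

/-- The square root of the increment of the ramps: the squares of the bumps sum to `1` on
`(0, 1]`, and each point is in the support of at most two consecutive ones. -/
noncomputable def bump (n : ℕ) (x : ℝ) : ℝ := √(ramp (n + 1) x - ramp n x)

theorem continuous_bump (n : ℕ) : Continuous (bump n) :=
  ((continuous_ramp (n + 1)).sub (continuous_ramp n)).sqrt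

theorem bump_apply_zero (n : ℕ) : bump n 0 = 0 := by simp [bump, ramp_apply_zero]

theorem bump_nonneg (n : ℕ) (x : ℝ) : 0 ≤ bump n x := Real.sqrt_nonneg _

theorem bump_le_one (n : ℕ) (x : ℝ) : bump n x ≤ 1 :=
  Real.sqrt_le_one.2 (by linarith [ramp_nonneg n x, ramp_le_one (n + 1) x])

theorem bump_mul_self (n : ℕ) (x : ℝ) : bump n x * bump n x = ramp (n + 1) x - ramp n x :=
  Real.mul_self_sqrt (sub_nonneg.2 (ramp_le_ramp n.le_succ x))

theorem bump_eq_zero {m n : ℕ} (hmn : m < n) {x : ℝ} (h : ramp m x ≠ 0) : bump n x = 0 := by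
  rw [bump, ramp_eq_one_of_ne_zero hmn h, ramp_eq_one_of_ne_zero (hmn.trans n.lt_succ_self) h,
    sub_self, Real.sqrt_zero]

theorem le_add_one_of_bump_ne_zero {m n : ℕ} {x : ℝ} (hm : bump m x ≠ 0) (hn : bump n x ≠ 0) :
    n ≤ m + 1 := by
  by_contra! hlt
  have hm1 : ramp (m + 1) x = 0 := not_not.1 fun h => hn (bump_eq_zero hlt h)
  refine hm (Real.sqrt_eq_zero_of_nonpos ?_)
  linarith [ramp_nonneg m x]

theorem bump_mul_bump_eq_zero {m n : ℕ} (h : m + 1 < n ∨ n + 1 < m) (x : ℝ) :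
    bump m x * bump n x = 0 := by
  by_contra hne
  have hm := left_ne_zero_of_mul hne
  have hn := right_ne_zero_of_mul hne
  have := le_add_one_of_bump_ne_zero hm hn
  have := le_add_one_of_bump_ne_zero hn hm
  omega

theorem sum_bump_le_two (s : Finset ℕ) (x : ℝ) : ∑ n ∈ s, bump n x ≤ 2 := by
  rw [← Finset.sum_filter_ne_zero]
  set S := {n ∈ s | bump n x ≠ 0}
  have hcard : S.card ≤ 2 := by
    obtain h | h := S.eq_empty_or_nonempty
    · simp [h]
    · have hne : ∀ n ∈ S, bump n x ≠ 0 := fun n hn => (Finset.mem_filter.1 hn).2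
      have hsub : S ⊆ Finset.Icc (S.min' h) (S.min' h + 1) := fun n hn =>
        Finset.mem_Icc.2 ⟨S.min'_le n hn,
          le_add_one_of_bump_ne_zero (hne _ (S.min'_mem h)) (hne n hn)⟩
      exact (Finset.card_le_card hsub).trans (by rw [Nat.card_Icc]; omega)
  calc ∑ n ∈ S, bump n x ≤ S.card • (1 : ℝ) :=
        Finset.sum_le_card_nsmul S _ 1 fun n _ => bump_le_one n x
    _ ≤ 2 := by simpa using (Nat.cast_le (α := ℝ)).2 hcard

theorem sum_range_bump_mul_self (N : ℕ) (x : ℝ) :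
    ∑ n ∈ Finset.range N, bump n x * bump n x = ramp N x - ramp 0 x := by
  simp only [bump_mul_self]
  exact Finset.sum_range_sub (fun n => ramp n x) N

theorem sum_bump_mul_self_le_one (s : Finset ℕ) (x : ℝ) :
    ∑ n ∈ s, bump n x * bump n x ≤ 1 := by
  obtain ⟨N, hN⟩ := s.exists_nat_subset_range
  calc ∑ n ∈ s, bump n x * bump n x ≤ ∑ n ∈ Finset.range N, bump n x * bump n x :=
        Finset.sum_le_sum_of_subset_of_nonneg hN fun n _ _ => mul_self_nonneg _
    _ = ramp N x - ramp 0 x := sum_range_bump_mul_self N x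
    _ ≤ 1 := by linarith [ramp_le_one N x, ramp_nonneg 0 x]

theorem ramp_mul_sum_bump_mul_self {N : ℕ} {s : Finset ℕ} (hs : Finset.range (N + 1) ⊆ s) {x : ℝ}
    (hx : x ≤ 1) : ramp N x * ∑ n ∈ s, bump n x * bump n x = ramp N x := by
  by_cases h : ramp N x = 0
  · rw [h, zero_mul]
  · have h0 : ramp 0 x = 0 := ramp_eq_zero (by simpa using hx)
    rw [← Finset.sum_subset hs, sum_range_bump_mul_self, h0,
      ramp_eq_one_of_ne_zero N.lt_succ_self h, sub_zero, mul_one]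
    intro n _ hn
    rw [bump_eq_zero (m := N) (by simpa using hn) h, zero_mul]

variable {B : Type*} [NonUnitalCStarAlgebra B]

theorem cfcₙ_bump_mul_cfcₙ_bump {m n : ℕ} (h : m + 1 < n ∨ n + 1 < m) (k : B) :
    cfcₙ (bump m) k * cfcₙ (bump n) k = 0 := by
  rw [← cfcₙ_mul (bump m) (bump n) k (continuous_bump m).continuousOn (bump_apply_zero m)
    (continuous_bump n).continuousOn (bump_apply_zero n)]
  simp only [bump_mul_bump_eq_zero h, cfcₙ_const_zero]

theorem norm_signedSum_cfcₙ_bump_le (k : B) (s : Finset ℕ) (ε : ℕ → ℤˣ) :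
    ‖∑ n ∈ s, ε n • cfcₙ (bump n) k‖ ≤ 2 := by
  have hε (n : ℕ) : ε n • cfcₙ (bump n) k = cfcₙ (fun x => ε n • bump n x) k := by
    obtain h | h := Int.units_eq_one_or (ε n) <;> simp [h, Units.smul_def, cfcₙ_neg]
  simp only [hε]
  rw [← cfcₙ_sum (fun n x => ε n • bump n x) k s
    (fun n _ => ((continuous_bump n).const_smul (ε n)).continuousOn)
    (fun n _ => by simp [bump_apply_zero])]
  refine norm_cfcₙ_le fun x _ => ?_
  rw [Finset.sum_apply]
  calc ‖∑ n ∈ s, ε n • bump n x‖ ≤ ∑ n ∈ s, ‖ε n • bump n x‖ := norm_sum_le _ _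
    _ = ∑ n ∈ s, bump n x := by
        refine Finset.sum_congr rfl fun n _ => ?_
        obtain h | h := Int.units_eq_one_or (ε n) <;>
          simp [h, Units.smul_def, abs_of_nonneg (bump_nonneg n x)]
    _ ≤ 2 := sum_bump_le_two s x

theorem continuous_sum_bump_mul_self (s : Finset ℕ) :
    Continuous fun x => ∑ n ∈ s, bump n x * bump n x :=
  continuous_finsetSum s fun n _ => (continuous_bump n).mul (continuous_bump n)

theorem sum_cfcₙ_bump_mul_self (k : B) (s : Finset ℕ) :
    ∑ n ∈ s, cfcₙ (bump n) k * cfcₙ (bump n) k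
      = cfcₙ (fun x => ∑ n ∈ s, bump n x * bump n x) k := by
  have hb (n : ℕ) := (continuous_bump n).continuousOn (s := quasispectrum ℝ k)
  rw [← Finset.sum_fn, cfcₙ_sum (fun n x => bump n x * bump n x) k s
    (fun n _ => (hb n).mul (hb n)) (fun n _ => by simp [bump_apply_zero])]
  exact Finset.sum_congr rfl fun n _ =>
    (cfcₙ_mul (bump n) (bump n) k (hb n) (bump_apply_zero n) (hb n) (bump_apply_zero n)).symm

theorem norm_sub_mul_sum_bump_le (k b : B) (s : Finset ℕ) :
    ‖b - b * ∑ n ∈ s, cfcₙ (bump n) k * cfcₙ (bump n) k‖ ≤ 2 * ‖b‖ := by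
  have hle : ‖∑ n ∈ s, cfcₙ (bump n) k * cfcₙ (bump n) k‖ ≤ 1 := by
    rw [sum_cfcₙ_bump_mul_self]
    refine norm_cfcₙ_le fun x _ => ?_
    rw [Real.norm_of_nonneg (Finset.sum_nonneg fun n _ => mul_self_nonneg _)]
    exact sum_bump_mul_self_le_one s x
  refine (norm_sub_le _ _).trans ?_
  linarith [(norm_mul_le b _).trans (mul_le_of_le_one_right (norm_nonneg b) hle)]

theorem norm_sub_mul_sum_bump_le_of_subset {k : B} (hsa : IsSelfAdjoint k) (hk : ‖k‖ ≤ 1) (b : B)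
    {N : ℕ} {s : Finset ℕ} (hs : Finset.range (N + 1) ⊆ s) :
    ‖b - b * ∑ n ∈ s, cfcₙ (bump n) k * cfcₙ (bump n) k‖ ≤ 2 * ‖b - b * cfcₙ (ramp N) k‖ := by
  have hspec (x : ℝ) (hx : x ∈ quasispectrum ℝ k) : x ≤ 1 := by
    have := norm_apply_le_norm_cfcₙ (fun x : ℝ => x) k hx
    rw [cfcₙ_id' ℝ k] at this
    exact (Real.le_norm_self x).trans (this.trans hk)
  have hramp : cfcₙ (ramp N) k * ∑ n ∈ s, cfcₙ (bump n) k * cfcₙ (bump n) k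
      = cfcₙ (ramp N) k := by
    rw [sum_cfcₙ_bump_mul_self, ← cfcₙ_mul (ramp N) _ k (continuous_ramp N).continuousOn
      (ramp_apply_zero N) (continuous_sum_bump_mul_self s).continuousOn
      (by simp [bump_apply_zero])]
    exact cfcₙ_congr fun x hx => ramp_mul_sum_bump_mul_self hs (hspec x hx)
  have := norm_sub_mul_sum_bump_le k (b - b * cfcₙ (ramp N) k) s
  rwa [sub_mul, mul_assoc b, hramp, sub_sub_sub_cancel_right] at this

end Bump

/-! ### Sections that are strictly positive on the fibres -/

theorem exists_pos_hasSum_smul {E : Type*} [NormedAddCommGroup E] [NormedSpace ℝ E]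
    [CompleteSpace E] {ι : Type*} [Countable ι] (p : ι → E) :
    ∃ (c : ι → ℝ) (x : E), (∀ i, 0 < c i) ∧ ‖x‖ ≤ 1 ∧ HasSum (fun i => c i • p i) x := by
  obtain ⟨δ, hδ, S, hS, hS1⟩ := NNReal.exists_pos_sum_of_countable one_ne_zero ι
  have hc (i : ι) : 0 < (δ i : ℝ) / (‖p i‖ + 1) := div_pos (hδ i) (by positivity)
  have hle (i : ι) : ‖((δ i : ℝ) / (‖p i‖ + 1)) • p i‖ ≤ δ i := by
    rw [norm_smul, Real.norm_of_nonneg (hc i).le, div_mul_eq_mul_div]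
    refine div_le_of_le_mul₀ (by positivity) (by positivity) ?_
    gcongr
    exact (lt_add_one _).le
  have hδS := NNReal.hasSum_coe.2 hS
  refine ⟨_, _, hc, ?_, (Summable.of_norm_bounded hδS.summable hle).hasSum⟩
  exact (tsum_of_norm_bounded hδS hle).trans hS1.le

namespace IsStrictlyPositiveElement

variable {B : Type v} [NonUnitalCStarAlgebra B] [PartialOrder B] [StarOrderedRing B] {h k : B}

theorem smul (hh : IsStrictlyPositiveElement h) {c : ℝ} (hc : 0 < c) :
    IsStrictlyPositiveElement (c • h) := by
  refine ⟨CStarAlgebra.nonneg_iff_eq_star_mul_self.1 (smul_nonneg hc.le hh.nonneg),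
    fun f hf hf0 => ?_⟩
  rw [map_real_smul f f.continuous, Complex.smul_re, smul_eq_mul]
  exact mul_pos hc (hh.2 f hf hf0)

theorem mono (hh : IsStrictlyPositiveElement h) (hk : h ≤ k) : IsStrictlyPositiveElement k := by
  refine ⟨CStarAlgebra.nonneg_iff_eq_star_mul_self.1 (hh.nonneg.trans hk), fun f hf hf0 => ?_⟩
  obtain ⟨b, hb⟩ := CStarAlgebra.nonneg_iff_eq_star_mul_self.1 (sub_nonneg.2 hk)
  rw [← add_sub_cancel h k, hb, map_add, Complex.add_re]
  exact add_pos_of_pos_of_nonneg (hh.2 f hf hf0) (hf b).1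

end IsStrictlyPositiveElement

namespace ContinuousField

variable {Ω : Type u} [TopologicalSpace Ω] {A : Ω → Type v} [∀ t, NonUnitalCStarAlgebra (A t)]
  {U : ContinuousField Ω A}

-- Instance search does not find this, as it does not unfold the algebra structure of `lp A ∞`.
instance (U : ContinuousField Ω A) :
    NonUnitalContinuousFunctionalCalculus ℝ U.sectionAlgebra IsSelfAdjoint :=
  IsSelfAdjoint.instNonUnitalContinuousFunctionalCalculus (A := U.sectionAlgebra)

theorem evalHom_cfcₙ {h : U.sectionAlgebra} (hh : IsSelfAdjoint h) {f : ℝ → ℝ}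
    (hf : Continuous f) (hf0 : f 0 = 0) (t : Ω) :
    U.evalHom t (cfcₙ f h) = cfcₙ f (U.evalHom t h) :=
  (U.evalHom t).map_cfcₙ f h hf.continuousOn hf0 (U.continuous_evalHom t) hh
    (hh.map (U.evalHom t))

/-- A self-adjoint section `h` of norm at most `1` that vanishes off `W` and whose values at the
points of `W` are strictly positive elements of the fibres. -/
structure IsStrictlyPositiveOn (h : U.sectionAlgebra) (W : Set Ω) : Prop where
  isSelfAdjoint : IsSelfAdjoint h
  norm_le_one : ‖h‖ ≤ 1
  evalHom_eq_zero : ∀ t ∉ W, U.evalHom t h = 0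
  isStrictlyPositiveElement : ∀ t ∈ W, IsStrictlyPositiveElement (U.evalHom t h)

variable [T2Space Ω] [LocallyCompactSpace Ω]

theorem IsLocallyTrivial.exists_eventually_isStrictlyPositiveElement (hU : U.IsLocallyTrivial)
    (hpos : U.HasStrictlyPositiveElements) {W : Set Ω} (hW : IsOpen W) {t₀ : Ω} (ht₀ : t₀ ∈ W) :
    ∃ q : U.sectionAlgebra, (∀ t ∉ W, U.evalHom t q = 0) ∧
      ∀ᶠ t in 𝓝 t₀, IsStrictlyPositiveElement (U.evalHom t (star q * q)) := by
  obtain ⟨V, hV, htV, B, _, ⟨e⟩⟩ := hU t₀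
  obtain ⟨h, hh⟩ := hpos t₀
  have hb := hh.map_equiv (e.φ ⟨t₀, htV⟩)
  obtain ⟨b, hhb⟩ := hb.1
  obtain ⟨g, hg1, hgc, hgVW⟩ := exists_continuousMap_eventuallyEq_one (hV.inter hW) ⟨htV, ht₀⟩
  obtain ⟨q, hq, hq0⟩ :=
    exists_evalHom_eq_symm_smul hV e hgc (hgVW.trans Set.inter_subset_left) b
  refine ⟨q, fun t ht => hq0 t fun htg => ht (hgVW htg).2, ?_⟩
  filter_upwards [hg1, hV.mem_nhds htV] with t ht htV
  have hqt : U.evalHom t q = (e.φ ⟨t, htV⟩).symm b := by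
    rw [hq ⟨t, htV⟩, ht, Complex.ofReal_one, one_smul]
  rw [map_mul, map_star, hqt, ← map_star, ← map_mul, ← hhb]
  exact hb.map_equiv (e.φ ⟨t, htV⟩).symm

theorem IsLocallyTrivial.exists_isStrictlyPositiveOn (hU : U.IsLocallyTrivial)
    (hpos : U.HasStrictlyPositiveElements) {W : Set Ω} (hW : IsOpen W) (hσ : IsSigmaCompact W) :
    ∃ h : U.sectionAlgebra, IsStrictlyPositiveOn h W := by
  choose q hq0 hq using
    fun t : W => hU.exists_eventually_isStrictlyPositiveElement hpos hW t.2
  have := isSigmaCompact_iff_sigmaCompactSpace.1 hσ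
  obtain ⟨J, _, f, hf⟩ := exists_countable_iUnion_eq_univ
    fun t : W => (continuous_subtype_val.tendsto t).eventually (hq t)
  have : CompleteSpace U.sectionAlgebra := U.isClosed_sectionAlgebra.completeSpace_coe
  obtain ⟨c, h, hc, hh1, hh⟩ := exists_pos_hasSum_smul fun j => star (q (f j)) * q (f j)
  have heval (t : Ω) : HasSum
      (fun j => c j • (star (U.evalHom t (q (f j))) * U.evalHom t (q (f j)))) (U.evalHom t h) := by
    convert hh.map (U.evalHom t) (U.continuous_evalHom t) with j
    rw [← map_star, ← map_mul]
    exact (map_real_smul _ (U.continuous_evalHom t) _ _).symm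
  have hzero (t : Ω) (ht : t ∉ W) : U.evalHom t h = 0 :=
    (heval t).unique (by simpa only [hq0 _ t ht, mul_zero, smul_zero] using hasSum_zero)
  have hstr (t : Ω) (ht : t ∈ W) : IsStrictlyPositiveElement (U.evalHom t h) := by
    let _ := CStarAlgebra.spectralOrder (A t)
    have := CStarAlgebra.spectralOrderedRing (A t)
    obtain ⟨j, hj⟩ := Set.mem_iUnion.1 (hf.symm ▸ Set.mem_univ (⟨t, ht⟩ : W))
    have hj : IsStrictlyPositiveElement (star (U.evalHom t (q (f j))) * U.evalHom t (q (f j))) := by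
      rw [← map_star, ← map_mul]
      exact hj
    exact (hj.smul (hc j)).mono
      (le_hasSum (heval t) j fun i _ => smul_nonneg (hc i).le (star_mul_self_nonneg _))
  refine ⟨h, ext_evalHom fun t => ?_, hh1, hzero, hstr⟩
  rw [map_star]
  by_cases ht : t ∈ W
  · obtain ⟨b, hb⟩ := (hstr t ht).1
    exact hb ▸ IsSelfAdjoint.star_mul_self b
  · rw [hzero t ht, star_zero]

end ContinuousField

/-! ### Left projectivity over a paracompact base -/

namespace ContinuousField

variable {Ω : Type u} [TopologicalSpace Ω] {A : Ω → Type v} [∀ t, NonUnitalCStarAlgebra (A t)]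
  {U : ContinuousField Ω A} {M : Type*} {W : M → Set Ω} {h : M → U.sectionAlgebra}

/-- The functional calculus of the members of a family of sections under the bump functions. For
sections that are strictly positive on the members of a partition of the base, this is the
almost orthogonal unit that makes the section algebra left projective. -/
noncomputable def bumpSection (h : M → U.sectionAlgebra) (i : M × ℕ) : U.sectionAlgebra :=
  cfcₙ (bump i.2) (h i.1)

section Values

variable (hW : IsOpenPartition W) (hh : ∀ μ, IsStrictlyPositiveOn (h μ) (W μ)) {μ : M} {t : Ω}

include hh

theorem evalHom_bumpSection (t : Ω) (i : M × ℕ) :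
    U.evalHom t (bumpSection h i) = cfcₙ (bump i.2) (U.evalHom t (h i.1)) :=
  evalHom_cfcₙ (hh i.1).isSelfAdjoint (continuous_bump i.2) (bump_apply_zero i.2) t

include hW

theorem evalHom_bumpSection_eq_zero (ht : t ∈ W μ) {i : M × ℕ} (hi : i.1 ≠ μ) :
    U.evalHom t (bumpSection h i) = 0 := by
  rw [evalHom_bumpSection hh, (hh i.1).evalHom_eq_zero t fun ht' => hi (hW.eq_of_mem ht' ht),
    cfcₙ_apply_zero]

theorem evalHom_signedSum_bumpSection (ht : t ∈ W μ) (s : Finset (M × ℕ)) (ε : M × ℕ → ℤˣ) :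
    U.evalHom t (∑ i ∈ s, ε i • bumpSection h i) =
      ∑ n ∈ s.preimage (Prod.mk μ) (Prod.mk_right_injective μ).injOn,
        ε (μ, n) • cfcₙ (bump n) (U.evalHom t (h μ)) := by
  have hsmul (i : M × ℕ) : U.evalHom t (ε i • bumpSection h i) =
      ε i • U.evalHom t (bumpSection h i) := by
    simp only [Units.smul_def, map_zsmul]
  rw [map_sum, ← Finset.sum_preimage (Prod.mk μ) s (Prod.mk_right_injective μ).injOn]
  · exact Finset.sum_congr rfl fun n _ => by rw [hsmul, evalHom_bumpSection hh]
  · rintro ⟨ν, n⟩ - hν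
    rw [hsmul, evalHom_bumpSection_eq_zero hW hh ht fun hνμ => hν ⟨n, by rw [← hνμ]⟩, smul_zero]

theorem evalHom_sub_sum_bumpSection (ht : t ∈ W μ) (b : U.sectionAlgebra) (s : Finset (M × ℕ)) :
    U.evalHom t (b - ∑ i ∈ s, b * bumpSection h i * bumpSection h i) =
      U.evalHom t b - U.evalHom t b *
        ∑ n ∈ s.preimage (Prod.mk μ) (Prod.mk_right_injective μ).injOn,
          cfcₙ (bump n) (U.evalHom t (h μ)) * cfcₙ (bump n) (U.evalHom t (h μ)) := by
  rw [map_sub, map_sum, ← Finset.sum_preimage (Prod.mk μ) s (Prod.mk_right_injective μ).injOn,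
    Finset.mul_sum]
  · exact congrArg _ (Finset.sum_congr rfl fun n _ => by
      rw [map_mul, map_mul, evalHom_bumpSection hh, mul_assoc])
  · rintro ⟨ν, n⟩ - hν
    rw [map_mul, evalHom_bumpSection_eq_zero hW hh ht fun hνμ => hν ⟨n, by rw [← hνμ]⟩, mul_zero]

theorem bumpSection_mul_bumpSection_eq_zero {i j : M × ℕ}
    (hij : i.1 ≠ j.1 ∨ i.2 + 1 < j.2 ∨ j.2 + 1 < i.2) :
    bumpSection h i * bumpSection h j = 0 := by
  refine ext_evalHom fun t => ?_
  rw [map_mul, map_zero]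
  obtain ⟨μ, ht⟩ := hW.exists_mem t
  by_cases hi : i.1 = μ
  · by_cases hj : j.1 = μ
    · rw [evalHom_bumpSection hh, evalHom_bumpSection hh, hi, hj]
      exact cfcₙ_bump_mul_cfcₙ_bump (hij.resolve_left fun h => h (hi.trans hj.symm)) _
    · rw [evalHom_bumpSection_eq_zero hW hh ht hj, mul_zero]
  · rw [evalHom_bumpSection_eq_zero hW hh ht hi, zero_mul]

theorem eventually_norm_evalHom_sub_sum_bumpSection_lt (b : U.sectionAlgebra) (t : Ω) {ε : ℝ}
    (hε : 0 < ε) :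
    ∀ᶠ p : Finset (M × ℕ) × Ω in atTop ×ˢ 𝓝 t,
      ‖U.evalHom p.2 (b - ∑ i ∈ p.1, b * bumpSection h i * bumpSection h i)‖ < ε := by
  obtain ⟨μ, ht⟩ := hW.exists_mem t
  have heval (N : ℕ) (r : Ω) : U.evalHom r (b - b * cfcₙ (ramp N) (h μ)) =
      U.evalHom r b - U.evalHom r b * cfcₙ (ramp N) (U.evalHom r (h μ)) := by
    rw [map_sub, map_mul, evalHom_cfcₙ (hh μ).isSelfAdjoint (continuous_ramp N) (ramp_apply_zero N)]
  obtain ⟨N, hN⟩ := ((((hh μ).isStrictlyPositiveElement t ht).tendsto_mul_cfcₙ_ramp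
    (U.evalHom t b)).eventually (Metric.ball_mem_nhds _ (half_pos hε))).exists
  rw [dist_comm, dist_eq_norm, ← heval] at hN
  have hnear : ∀ᶠ r in 𝓝 t, r ∈ W μ ∧ ‖U.evalHom r (b - b * cfcₙ (ramp N) (h μ))‖ < ε / 2 :=
    ((hW.isOpen μ).eventually_mem ht).and
      ((U.continuous_norm _ (evalHom_mem _)).continuousAt.eventually_lt_const hN)
  filter_upwards [prod_mem_prod (mem_atTop ((Finset.range (N + 1)).map
    ⟨Prod.mk μ, Prod.mk_right_injective μ⟩)) hnear]
  rintro ⟨s, r⟩ ⟨hs, hrW, hr⟩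
  rw [evalHom_sub_sum_bumpSection hW hh hrW]
  refine (norm_sub_mul_sum_bump_le_of_subset ((hh μ).isSelfAdjoint.map (U.evalHom r))
    ((norm_evalHom_le r _).trans (hh μ).norm_le_one) _ (N := N) fun n hn => ?_).trans_lt ?_
  · exact Finset.mem_preimage.2 (hs (Finset.mem_map_of_mem _ hn))
  · rw [← heval]
    linarith

theorem hasSum_mul_bumpSection_mul_bumpSection (b : U.sectionAlgebra) :
    HasSum (fun i => b * bumpSection h i * bumpSection h i) b := by
  rw [HasSum, SummationFilter.unconditional_filter, Metric.tendsto_nhds]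
  intro ε hε
  obtain ⟨K, hK, hKb⟩ := mem_cocompact.1
    ((tendsto_norm_evalHom b).eventually_lt_const (show 0 < ε / 4 by positivity))
  have hcompact : ∀ᶠ p : Finset (M × ℕ) × Ω in atTop ×ˢ 𝓝ˢ K,
      ‖U.evalHom p.2 (b - ∑ i ∈ p.1, b * bumpSection h i * bumpSection h i)‖ < ε / 2 :=
    hK.mem_prod_nhdsSet_of_forall fun t _ =>
      eventually_norm_evalHom_sub_sum_bumpSection_lt hW hh b t (half_pos hε)
  filter_upwards [hcompact.curry] with s hs
  rw [dist_comm, dist_eq_norm]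
  refine (norm_le_of_forall_norm_evalHom_le (half_pos hε).le fun r => ?_).trans_lt (half_lt_self hε)
  by_cases hr : r ∈ K
  · exact (hs.self_of_nhdsSet r hr).le
  · obtain ⟨μ, hrμ⟩ := hW.exists_mem r
    rw [evalHom_sub_sum_bumpSection hW hh hrμ]
    have hrb : ‖U.evalHom r b‖ < ε / 4 := hKb hr
    exact (norm_sub_mul_sum_bump_le _ _ _).trans (by linarith)

theorem isAlmostOrthogonalUnit_bumpSection : IsAlmostOrthogonalUnit (bumpSection h) 2 where
  norm_signedSum_le s ε := norm_le_of_forall_norm_evalHom_le zero_le_two fun t => by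
    obtain ⟨μ, ht⟩ := hW.exists_mem t
    rw [evalHom_signedSum_bumpSection hW hh ht]
    exact norm_signedSum_cfcₙ_bump_le _ _ fun n => ε (μ, n)
  finite_mul_ne_zero i := by
    refine ((Set.finite_Icc (i.2 - 1) (i.2 + 1)).image fun n => (i.1, n)).subset ?_
    rintro ⟨ν, m⟩ hne
    by_contra hnot
    refine hne (bumpSection_mul_bumpSection_eq_zero hW hh ?_)
    by_contra! hcon
    exact hnot ⟨m, ⟨by omega, by omega⟩, by rw [hcon.1]⟩
  hasSum_mul_mul := hasSum_mul_bumpSection_mul_bumpSection hW hh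

end Values

theorem IsLocallyTrivial.isLeftProjective [T2Space Ω] [LocallyCompactSpace Ω]
    (hU : U.IsLocallyTrivial) (hpos : U.HasStrictlyPositiveElements)
    (hW : IsSigmaCompactPartition W) : IsLeftProjective.{max u v, w} U.sectionAlgebra := by
  choose h hh using
    fun μ => hU.exists_isStrictlyPositiveOn hpos (hW.isOpen μ) (hW.isSigmaCompact μ)
  exact (isAlmostOrthogonalUnit_bumpSection hW.toIsOpenPartition hh).isLeftProjective

end ContinuousField

theorem theorem6p16_general {Ω : Type u} [TopologicalSpace Ω] [LocallyCompactSpace Ω] [T2Space Ω]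
    {A : Ω → Type v} [∀ t, NonUnitalCStarAlgebra (A t)] [∀ t, Nontrivial (A t)]
    (U : ContinuousField Ω A) (hU : U.IsLocallyTrivial)
    (hpos : U.HasStrictlyPositiveElements) :
    (ParacompactSpace Ω ↔
      IsLeftProjective.{max u v, w} U.sectionAlgebra ∧ U.IsDisjointUnionOfSigmaLocallyTrivial) ∧
    (ParacompactSpace Ω ∨
        (IsLeftProjective.{max u v, w} U.sectionAlgebra ∧
          U.IsDisjointUnionOfSigmaLocallyTrivial) →
      ∀ (X : Type (max u v w)) [NormedAddCommGroup X] [NormedSpace ℂ X] [CompleteSpace X]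
        (m : BanachBimodule U.sectionAlgebra X), m.IsRightAnnihilator →
        Subsingleton (m.Cohomology 2)) := by
  have hproj (hP : ParacompactSpace Ω) : IsLeftProjective.{max u v, w} U.sectionAlgebra ∧
      U.IsDisjointUnionOfSigmaLocallyTrivial := by
    obtain ⟨M, W, hW⟩ := exists_isSigmaCompactPartition Ω
    exact ⟨hU.isLeftProjective hpos hW, hU.isDisjointUnionOfSigmaLocallyTrivial hpos hW⟩
  refine ⟨⟨hproj, fun h => h.2.paracompactSpace h.1⟩, fun h X _ _ _ m hm => ?_⟩
  have : CompleteSpace U.sectionAlgebra := U.isClosed_sectionAlgebra.completeSpace_coe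
  exact (h.elim hproj id).1.subsingleton_cohomology_two hm

theorem theorem6p16 {Ω : Type u} [TopologicalSpace Ω] [LocallyCompactSpace Ω] [T2Space Ω]
    (ℓ : ℕ) (hdim : TopologicalDimLE Ω ℓ)
    {A : Ω → Type v} [∀ t, NonUnitalCStarAlgebra (A t)] [∀ t, Nontrivial (A t)]
    (U : ContinuousField Ω A) (hU : U.IsLocallyTrivial)
    (hpos : U.HasStrictlyPositiveElements) :
    (ParacompactSpace Ω ↔
      IsLeftProjective.{max u v, w} U.sectionAlgebra ∧ U.IsDisjointUnionOfSigmaLocallyTrivial) ∧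
    (ParacompactSpace Ω ∨
        (IsLeftProjective.{max u v, w} U.sectionAlgebra ∧
          U.IsDisjointUnionOfSigmaLocallyTrivial) →
      ∀ (X : Type (max u v w)) [NormedAddCommGroup X] [NormedSpace ℂ X] [CompleteSpace X]
        (m : BanachBimodule U.sectionAlgebra X), m.IsRightAnnihilator →
        Subsingleton (m.Cohomology 2)) :=
  theorem6p16_general U hU hpos
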